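/- Let $\mathbf{Loc}$ be the category of locales, ordered by $f\le g$ iff $f^*v\le g^*v$ for all opens $v$, and let $\mathbb{S}$ be the Sierpiński locale, so that morphisms $B\to\mathbb{S}$ correspond to opens of $B$ (equivalently, by complementation, to closed sublocales of $B$). Write $\vee$ for the internal join $\mathbb{S}\times\mathbb{S}\to\mathbb{S}$ and for the induced operations on $\mathbb{S}^Y$, and $\bot\colon 1\to\mathbb{S}^1$ for the bottom point. Let $X$ be a compact Hausdorff locale, that is, $X$ is compact and the diagonal $X\to X\times X$ is proper (a closed sublocale). Then $X$ admits a dual presentation with generators $[=x]$ for $x\in X$ and relations $[=x]\wedge[=y]\vdash x=y$ for $x,y\in X$ and $\top\vdash\bigvee_{x\in X}[=x]$. Explicitly: 1. The locales $X$, $X\times X$ and $1$ indexing the generators and relations are compact Hausdorff, and the exponentials $\mathbb{S}^X$, $\mathbb{S}^{X\times X}$ and $\mathbb{S}^1$ exist in $\mathbf{Loc}$. 2. For any choice of these exponentials, let $i\colon X\to\mathbb{S}^X$ and $d\colon 1\to\mathbb{S}^{X\times X}$ be the exponential transposes of the morphism $X\times X\to\mathbb{S}$ (respectively $1\times X\times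 X\to\mathbb{S}$) corresponding to the closed diagonal of $X$. The morphism $\mathbb{S}^{!}\colon\mathbb{S}^1\to\mathbb{S}^X$ has a right adjoint $(\mathbb{S}^{!})_*\colon\mathbb{S}^X\to\mathbb{S}^1$, and this corresponds to taking images of closeds: if $h\colon A\to\mathbb{S}^X$ classifies the open $u$ of $A\times X$, then $(\mathbb{S}^{!})_*\circ h$ classifies $p_*(u)$, where $p=A\times{!}\colon A\times X\to A\times 1$ and $p_*$ is the right adjoint of $p^*$. 3. The morphism $i$ is the inserter of $$(d\circ{!},\,(\mathbb{S}^{!})_*)\;\le\;(\mathbb{S}^{\pi_1}\vee\mathbb{S}^{\pi_2},\,\bot\circ{!})\colon\ \mathbb{S}^X\rightrightarrows\mathbb{S}^{X\times X}\times\mathbb{S}^1 .$$ That is, writing $g$ and $f$ for the left-hand and right-hand morphisms: $g\circ i\le f\circ i$; every $h\colon A\to\mathbb{S}^X$ with $g\circ h\le f\circ h$ factors uniquely as $h=i\circ k$ with $k\colon A\to X$; and for $k,k'\colon A\to X$, $i\circ k\le i\circ k'$ implies $k\le k'$. -/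

import Mathlib

open CategoryTheory MonoidalCategory CartesianMonoidalCategory

universe u

namespace CompactHausdorffLocale

/-! ## Locale morphisms, their inverse and direct images, and their order -/

/-- The locale morphism given by a frame homomorphism in the opposite direction. -/
def ofFrameHom {X Y : Locale.{u}} (φ : FrameHom Y X) : X ⟶ Y :=
  Quiver.Hom.op (Frm.ofHom φ)

/-- The frame homomorphism `f^* : O Y → O X` of a locale morphism `f : X ⟶ Y`. -/
def inverseImage {X Y : Locale.{u}} (f : X ⟶ Y) : FrameHom Y X :=
  f.unop.hom

theorem inverseImage_ofFrameHom {X Y : Locale.{u}} (φ : FrameHom Y X) :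
    inverseImage (ofFrameHom φ) = φ := rfl

theorem inverseImage_comp {X Y Z : Locale.{u}} (f : X ⟶ Y) (g : Y ⟶ Z) (w : Z) :
    inverseImage (f ≫ g) w = inverseImage f (inverseImage g w) := rfl

theorem locale_hom_ext {X Y : Locale.{u}} {f g : X ⟶ Y}
    (h : ∀ v : Y, inverseImage f v = inverseImage g v) : f = g :=
  Quiver.Hom.unop_inj (Frm.ext h)

/-- The pointwise order on locale morphisms: `f ≤ g` iff `f^* v ≤ g^* v` for every open `v`. -/
instance homPartialOrder (X Y : Locale.{u}) : PartialOrder (X ⟶ Y) where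
  le f g := ∀ v : Y, inverseImage f v ≤ inverseImage g v
  le_refl _ _ := le_rfl
  le_trans _ _ _ h₁ h₂ v := (h₁ v).trans (h₂ v)
  le_antisymm _ _ h₁ h₂ := locale_hom_ext fun v => le_antisymm (h₁ v) (h₂ v)

/-- The right adjoint `f_* : O X → O Y` of `f^*`. In terms of closed sublocales (complements of
opens) it sends a closed sublocale of `X` to the closure of its image in `Y`. -/
def directImage {X Y : Locale.{u}} (f : X ⟶ Y) (a : X) : Y :=
  sSup {v : Y | inverseImage f v ≤ a}

theorem le_directImage_iff {X Y : Locale.{u}} (f : X ⟶ Y) (a : X) (v : Y) :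
    v ≤ directImage f a ↔ inverseImage f v ≤ a := by
  constructor
  · intro h
    refine (OrderHomClass.mono (inverseImage f) h).trans ?_
    unfold directImage
    rw [map_sSup]
    refine sSup_le ?_
    rintro _ ⟨w, hw, rfl⟩
    exact hw
  · intro h
    exact le_sSup h

/-- `f` is proper: `f_*` preserves directed joins and satisfies Frobenius reciprocity. -/
structure IsProperMap {X Y : Locale.{u}} (f : X ⟶ Y) : Prop where
  directed : ∀ s : Set X, s.Nonempty → DirectedOn (· ≤ ·) s →
    directImage f (sSup s) = sSup (directImage f '' s)
  frobenius : ∀ (v : Y) (a : X), directImage f (inverseImage f v ⊔ a) = v ⊔ directImage f a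

/-! ## Finite products of locales -/

/-- The frame of opens of the product of two locales: the lower sets `U` of `A × B` such that
`(⋁ s, b) ∈ U` whenever `(a, b) ∈ U` for all `a ∈ s`, and symmetrically in the other variable. -/
def prodFrame (A B : Type u) [Order.Frame A] [Order.Frame B] : Sublocale (LowerSet (A × B)) where
  carrier := {U | (∀ (s : Set A) (b : B), (∀ a ∈ s, (a, b) ∈ U) → (sSup s, b) ∈ U) ∧
    (∀ (a : A) (t : Set B), (∀ b ∈ t, (a, b) ∈ U) → (a, sSup t) ∈ U)}
  sInf_mem' S hS := by
    refine ⟨fun s b h => ?_, fun a t h => ?_⟩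
    · simp only [LowerSet.mem_sInf_iff] at h ⊢
      exact fun U hU => (hS hU).1 s b fun a ha => h a ha U hU
    · simp only [LowerSet.mem_sInf_iff] at h ⊢
      exact fun U hU => (hS hU).2 a t fun b hb => h b hb U hU
  himp_mem' U V hV := by
    have key : ∀ p : A × B, p ∈ (U ⇨ V) ↔ ∀ q ≤ p, q ∈ U → q ∈ V := by
      intro p
      rw [← LowerSet.Iic_le, le_himp_iff]
      constructor
      · intro h q hq hqU
        exact h (show q ∈ LowerSet.Iic p ⊓ U from ⟨hq, hqU⟩)
      · intro h q hq
        exact h q hq.1 hq.2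
    refine ⟨fun s b h => ?_, fun a t h => ?_⟩
    · rw [key]
      rintro ⟨x, y⟩ ⟨hx, hy⟩ hU
      have hx' : x = sSup ((fun a => x ⊓ a) '' s) := by
        rw [sSup_image, ← inf_sSup_eq]
        exact (inf_eq_left.2 hx).symm
      rw [hx']
      refine hV.1 _ _ ?_
      rintro _ ⟨a, ha, rfl⟩
      exact (key _).1 (h a ha) _ ⟨inf_le_right, hy⟩ (U.lower
        (show (x ⊓ a, y) ≤ (x, y) from ⟨inf_le_left, le_rfl⟩) hU)
    · rw [key]
      rintro ⟨x, y⟩ ⟨hx, hy⟩ hU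
      have hy' : y = sSup ((fun b => y ⊓ b) '' t) := by
        rw [sSup_image, ← inf_sSup_eq]
        exact (inf_eq_left.2 hy).symm
      rw [hy']
      refine hV.2 _ _ ?_
      rintro _ ⟨b, hb, rfl⟩
      exact (key _).1 (h b hb) _ ⟨hx, inf_le_right⟩ (U.lower
        (show (x, y ⊓ b) ≤ (x, y) from ⟨le_rfl, inf_le_left⟩) hU)

section Product

variable {A B C : Type u} [Order.Frame A] [Order.Frame B] [Order.Frame C]

theorem restrict_le_iff (p : A × B) (W : prodFrame A B) :
    (prodFrame A B).restrict (LowerSet.Iic p) ≤ W ↔ p ∈ W.1 := by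
  rw [(prodFrame A B).giRestrict.gc.le_iff_le]
  exact LowerSet.Iic_le

/-- `a ↦ a × B`, the inverse image map of the first projection. -/
def prodInl (A B : Type u) [Order.Frame A] [Order.Frame B] : FrameHom A (prodFrame A B) where
  toFun a := (prodFrame A B).restrict (LowerSet.Iic (a, ⊤))
  map_inf' a a' := by
    rw [← map_inf, ← LowerSet.Iic_inf, Prod.mk_inf_mk, inf_top_eq]
  map_top' := by
    rw [← map_top (prodFrame A B).restrict]
    exact congrArg _ LowerSet.Iic_top
  map_sSup' s := by
    refine eq_of_forall_ge_iff fun W => ?_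
    rw [restrict_le_iff, sSup_le_iff, Set.forall_mem_image]
    constructor
    · intro h a ha
      rw [restrict_le_iff]
      exact W.1.lower (show (a, (⊤ : B)) ≤ (sSup s, ⊤) from ⟨le_sSup ha, le_rfl⟩) h
    · intro h
      exact W.2.1 s ⊤ fun a ha => (restrict_le_iff _ W).1 (h ha)

/-- `b ↦ A × b`, the inverse image map of the second projection. -/
def prodInr (A B : Type u) [Order.Frame A] [Order.Frame B] : FrameHom B (prodFrame A B) where
  toFun b := (prodFrame A B).restrict (LowerSet.Iic (⊤, b))
  map_inf' a a' := by
    rw [← map_inf, ← LowerSet.Iic_inf, Prod.mk_inf_mk, inf_top_eq]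
  map_top' := by
    rw [← map_top (prodFrame A B).restrict]
    exact congrArg _ LowerSet.Iic_top
  map_sSup' s := by
    refine eq_of_forall_ge_iff fun W => ?_
    rw [restrict_le_iff, sSup_le_iff, Set.forall_mem_image]
    constructor
    · intro h a ha
      rw [restrict_le_iff]
      exact W.1.lower (show ((⊤ : A), a) ≤ (⊤, sSup s) from ⟨le_rfl, le_sSup ha⟩) h
    · intro h
      exact W.2.2 ⊤ s fun a ha => (restrict_le_iff _ W).1 (h ha)

theorem prodInl_inf_prodInr (p : A × B) :
    prodInl A B p.1 ⊓ prodInr A B p.2 = (prodFrame A B).restrict (LowerSet.Iic p) := by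
  change (prodFrame A B).restrict _ ⊓ (prodFrame A B).restrict _ = _
  rw [← map_inf, ← LowerSet.Iic_inf, Prod.mk_inf_mk, inf_top_eq, top_inf_eq]

theorem prodFrame_eq_iSup (W : prodFrame A B) :
    W = ⨆ p ∈ W.1, prodInl A B p.1 ⊓ prodInr A B p.2 := by
  refine eq_of_forall_ge_iff fun V => ?_
  simp only [prodInl_inf_prodInr, iSup_le_iff, restrict_le_iff]
  exact Iff.rfl

/-- The opens of the product that are mapped below `c` by the copairing of `f` and `g`. -/
def prodDescAdj (f : FrameHom A C) (g : FrameHom B C) (c : C) : prodFrame A B where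
  val := ⟨{p | f p.1 ⊓ g p.2 ≤ c}, fun _ _ h hp =>
    (inf_le_inf (OrderHomClass.mono f h.1) (OrderHomClass.mono g h.2)).trans hp⟩
  property := by
    refine ⟨fun s b h => ?_, fun a t h => ?_⟩
    · change f (sSup s) ⊓ g b ≤ c
      rw [map_sSup, sSup_inf_eq]
      refine iSup₂_le ?_
      rintro _ ⟨a, ha, rfl⟩
      exact h a ha
    · change f a ⊓ g (sSup t) ≤ c
      rw [map_sSup, inf_sSup_eq]
      refine iSup₂_le ?_
      rintro _ ⟨b, hb, rfl⟩
      exact h b hb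

theorem prodDesc_gc (f : FrameHom A C) (g : FrameHom B C) :
    GaloisConnection (fun W : prodFrame A B => ⨆ p ∈ W.1, f p.1 ⊓ g p.2) (prodDescAdj f g) := by
  intro W c
  simp only [iSup_le_iff]
  exact Iff.rfl

/-- The copairing of two frame homomorphisms out of the frame of opens of a product. -/
def prodDesc (f : FrameHom A C) (g : FrameHom B C) : FrameHom (prodFrame A B) C where
  toFun W := ⨆ p ∈ W.1, f p.1 ⊓ g p.2
  map_inf' W V := by
    refine le_antisymm (le_inf ((prodDesc_gc f g).monotone_l inf_le_left)
      ((prodDesc_gc f g).monotone_l inf_le_right)) ?_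
    simp only [iSup_inf_eq, inf_iSup_eq]
    refine iSup₂_le fun q hq => iSup₂_le fun p hp => ?_
    refine le_trans ?_ (le_iSup₂_of_le (p ⊓ q)
      ⟨W.1.lower inf_le_left hp, V.1.lower inf_le_right hq⟩ le_rfl)
    simp only [Prod.fst_inf, Prod.snd_inf, map_inf]
    apply le_of_eq
    ac_rfl
  map_top' := by
    refine le_antisymm le_top (le_iSup₂_of_le (⊤, ⊤) ?_ (by simp))
    trivial
  map_sSup' s := by
    rw [(prodDesc_gc f g).l_sSup, sSup_image]

theorem prodDesc_inl (f : FrameHom A C) (g : FrameHom B C) (a : A) :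
    prodDesc f g (prodInl A B a) = f a := by
  refine eq_of_forall_ge_iff fun c => ?_
  refine ((prodDesc_gc f g).le_iff_le).trans ((restrict_le_iff _ _).trans ?_)
  change f a ⊓ g ⊤ ≤ c ↔ _
  rw [map_top, inf_top_eq]

theorem prodDesc_inr (f : FrameHom A C) (g : FrameHom B C) (b : B) :
    prodDesc f g (prodInr A B b) = g b := by
  refine eq_of_forall_ge_iff fun c => ?_
  refine ((prodDesc_gc f g).le_iff_le).trans ((restrict_le_iff _ _).trans ?_)
  change f ⊤ ⊓ g b ≤ c ↔ _
  rw [map_top, top_inf_eq]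

theorem prodFrame_hom_ext {φ ψ : FrameHom (prodFrame A B) C}
    (h₁ : ∀ a, φ (prodInl A B a) = ψ (prodInl A B a))
    (h₂ : ∀ b, φ (prodInr A B b) = ψ (prodInr A B b)) (W : prodFrame A B) : φ W = ψ W := by
  rw [prodFrame_eq_iSup W]
  simp only [map_iSup, map_inf, h₁, h₂]

end Product

/-- The binary product of locales, with its projections. -/
def prodCone (X Y : Locale.{u}) : Limits.BinaryFan X Y :=
  Limits.BinaryFan.mk (P := Locale.of (prodFrame X Y))
    (ofFrameHom (prodInl X Y)) (ofFrameHom (prodInr X Y))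

/-- It has the universal property of the product. -/
def prodConeIsLimit (X Y : Locale.{u}) : Limits.IsLimit (prodCone X Y) :=
  Limits.BinaryFan.IsLimit.mk _
    (fun f g => ofFrameHom (prodDesc (inverseImage f) (inverseImage g)))
    (fun f g => locale_hom_ext fun a => prodDesc_inl (inverseImage f) (inverseImage g) a)
    (fun f g => locale_hom_ext fun b => prodDesc_inr (inverseImage f) (inverseImage g) b)
    (fun f g m h₁ h₂ => locale_hom_ext fun W => by
      refine prodFrame_hom_ext (φ := inverseImage m) (fun a => ?_) (fun b => ?_) W
      · have hm : inverseImage m (prodInl X Y a) = inverseImage f a := by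
          rw [← h₁]
          rfl
        exact hm.trans (prodDesc_inl (inverseImage f) (inverseImage g) a).symm
      · have hm : inverseImage m (prodInr X Y b) = inverseImage g b := by
          rw [← h₂]
          rfl
        exact hm.trans (prodDesc_inr (inverseImage f) (inverseImage g) b).symm)

/-- The one-point locale, whose opens are the subsets of a singleton. -/
def pointLocale : Locale.{u} := Locale.of (Set PUnit.{u + 1})

/-- The inverse image map of the unique morphism to the one-point locale. -/
def pointDesc (C : Type u) [Order.Frame C] : FrameHom (Set PUnit.{u + 1}) C where
  toFun U := ⨆ _ : PUnit.unit ∈ U, ⊤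
  map_inf' U V := by
    by_cases h₁ : PUnit.unit ∈ U <;> by_cases h₂ : PUnit.unit ∈ V <;> simp [h₁, h₂]
  map_top' := by simp
  map_sSup' s := by
    refine eq_of_forall_ge_iff fun c => ?_
    simp only [iSup_le_iff, sSup_le_iff, Set.forall_mem_image]
    constructor
    · intro h U hU hx
      exact h ⟨U, hU, hx⟩
    · rintro h ⟨U, hU, hx⟩
      exact h hU hx

/-- The one-point locale is terminal. -/
def pointLocaleIsTerminal : Limits.IsTerminal pointLocale.{u} :=
  Limits.IsTerminal.ofUniqueHom (fun X => ofFrameHom (pointDesc X)) fun X m =>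
    locale_hom_ext fun U => by
      change inverseImage m U = pointDesc X U
      rcases Set.eq_empty_or_nonempty U with h | ⟨x, hx⟩
      · have hU : U = (⊥ : Set PUnit) := h
        rw [hU]
        exact (map_bot (inverseImage m)).trans (map_bot (pointDesc X)).symm
      · have hU : U = (⊤ : Set PUnit) := Set.eq_univ_of_forall fun y => hx
        rw [hU]
        exact (map_top (inverseImage m)).trans (map_top (pointDesc X)).symm

/-- Finite products of locales: `X ⊗ Y` is the product `X × Y` and `𝟙_ Locale` is the
terminal locale `1`. -/
instance localeCartesian : CartesianMonoidalCategory Locale.{u} :=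
  CartesianMonoidalCategory.ofChosenFiniteProducts
    ⟨Limits.asEmptyCone pointLocale, pointLocaleIsTerminal⟩
    fun X Y => ⟨prodCone X Y, prodConeIsLimit X Y⟩

/-! ## Compact Hausdorff locales -/

/-- A directed family of opens with join `⊤` contains `⊤`. -/
def IsCompactLocale (X : Locale.{u}) : Prop :=
  ∀ s : Set X, s.Nonempty → DirectedOn (· ≤ ·) s → sSup s = ⊤ → ⊤ ∈ s

/-- The diagonal `X ⟶ X × X`. -/
def diagonal (X : Locale.{u}) : X ⟶ X ⊗ X := lift (𝟙 X) (𝟙 X)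

/-- The diagonal is a closed (that is, proper) sublocale. -/
def IsHausdorffLocale (X : Locale.{u}) : Prop := IsProperMap (diagonal X)

/-- Compact Hausdorff locales. -/
structure IsCompactHausdorff (X : Locale.{u}) : Prop where
  compact : IsCompactLocale X
  hausdorff : IsHausdorffLocale X

/-- The open of `X × X` complementary to the (closure of the) diagonal: the largest open whose
inverse image along the diagonal is `⊥`. -/
def diagonalCompl (X : Locale.{u}) : (X ⊗ X : Locale.{u}) := directImage (diagonal X) ⊥

/-! ## The Sierpiński locale -/

/-- The Sierpiński locale `𝕊`, the locale of opens of the Sierpiński space `Prop`. -/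
def sierpinski : Locale.{u} := Locale.of (TopologicalSpace.Opens (ULift.{u} Prop))

/-- The open `{True}` of the Sierpiński space. -/
def trueOpens : TopologicalSpace.Opens (ULift.{u} Prop) :=
  ⟨ULift.down ⁻¹' {True}, isOpen_singleton_true.preimage continuous_uliftDown⟩

theorem mem_trueOpens (x : ULift.{u} Prop) : x ∈ trueOpens ↔ x.down = True := Iff.rfl

/-- The generic open `{True}` of the Sierpiński locale. -/
def genericOpen : sierpinski.{u} := trueOpens

theorem eq_top_of_false_mem (U : TopologicalSpace.Opens (ULift.{u} Prop))
    (h : ULift.up False ∈ U) : U = ⊤ := by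
  obtain ⟨V, hV, hVU⟩ := U.isOpen
  have hF : False ∈ V := by
    have h' : ULift.up False ∈ (U : Set (ULift.{u} Prop)) := h
    rw [← hVU] at h'
    exact h'
  have hV' : V = Set.univ := by
    have h' := hV.mem_nhds hF
    rwa [nhds_false, Filter.mem_top] at h'
  refine TopologicalSpace.Opens.ext ?_
  rw [← hVU, hV']
  rfl

/-- The frame homomorphism from the opens of the Sierpiński locale sending `{True}` to `b`. -/
def sierpinskiDesc {B : Type u} [Order.Frame B] (b : B) :
    FrameHom (TopologicalSpace.Opens (ULift.{u} Prop)) B where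
  toFun U := (⨆ _ : ULift.up False ∈ U, ⊤) ⊔ ⨆ _ : ULift.up True ∈ U, b
  map_inf' U V := by
    by_cases hU : ULift.up False ∈ U
    · rw [eq_top_of_false_mem U hU]
      simp
    by_cases hV : ULift.up False ∈ V
    · rw [eq_top_of_false_mem V hV]
      simp
    by_cases hU' : ULift.up True ∈ U <;> by_cases hV' : ULift.up True ∈ V <;>
      simp [hU, hV, hU', hV']
  map_top' := by simp
  map_sSup' s := by
    refine eq_of_forall_ge_iff fun c => ?_
    simp only [sup_le_iff, iSup_le_iff, sSup_le_iff, Set.forall_mem_image,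
      TopologicalSpace.Opens.mem_sSup]
    constructor
    · rintro ⟨h₁, h₂⟩ U hU
      exact ⟨fun h => h₁ ⟨U, hU, h⟩, fun h => h₂ ⟨U, hU, h⟩⟩
    · intro h
      exact ⟨fun ⟨U, hU, hx⟩ => (h hU).1 hx, fun ⟨U, hU, hx⟩ => (h hU).2 hx⟩

/-- Locale morphisms `B ⟶ 𝕊` correspond to opens of `B` (equivalently, by complementation, to
closed sublocales of `B`). -/
def opensEquiv (B : Locale.{u}) : (B ⟶ sierpinski.{u}) ≃ B where
  toFun f := inverseImage f genericOpen
  invFun b := ofFrameHom (sierpinskiDesc b)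
  left_inv f := by
    refine locale_hom_ext fun (U : TopologicalSpace.Opens (ULift.{u} Prop)) => ?_
    change sierpinskiDesc (inverseImage f genericOpen) U = inverseImage f U
    by_cases hF : ULift.up False ∈ U
    · rw [eq_top_of_false_mem U hF]
      exact (map_top _).trans (map_top (inverseImage f)).symm
    · by_cases hT : ULift.up True ∈ U
      · have hU : U = trueOpens := by
          refine TopologicalSpace.Opens.ext (Set.ext fun x => ?_)
          refine Iff.trans ?_ (mem_trueOpens x).symm
          obtain ⟨p⟩ := x
          by_cases hp : p <;> simp [hp, hF, hT]
        have hb : sierpinskiDesc (inverseImage f genericOpen) U = inverseImage f genericOpen := by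
          simp [sierpinskiDesc, hF, hT]
        rw [hb, hU]
        rfl
      · have hU : U = ⊥ := by
          refine TopologicalSpace.Opens.ext (Set.ext fun x => ?_)
          obtain ⟨p⟩ := x
          by_cases hp : p <;> simp [hp, hF, hT]
        rw [hU]
        exact (map_bot _).trans (map_bot (inverseImage f)).symm
  right_inv b := by
    have hF : ULift.up False ∉ trueOpens.{u} := by simp [mem_trueOpens]
    have hT : ULift.up True ∈ trueOpens.{u} := by simp [mem_trueOpens]
    change (⨆ _ : ULift.up False ∈ trueOpens.{u}, ⊤) ⊔ (⨆ _ : ULift.up True ∈ trueOpens.{u}, b) = b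
    simp [hF, hT]

/-- The internal join operation `∨ : 𝕊 × 𝕊 ⟶ 𝕊`. -/
def sierpinskiJoin : (sierpinski ⊗ sierpinski : Locale.{u}) ⟶ sierpinski :=
  (opensEquiv _).symm
    (inverseImage (fst sierpinski sierpinski) genericOpen ⊔
      inverseImage (snd sierpinski sierpinski) genericOpen)

/-- The point `⊥ : 1 ⟶ 𝕊`. -/
def sierpinskiBot : 𝟙_ Locale.{u} ⟶ sierpinski :=
  (opensEquiv _).symm ⊥

/-! ## Exponentials of the Sierpiński locale -/

/-- An exponential `𝕊^X` in the category of locales. -/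
structure SierpinskiPower (X : Locale.{u}) where
  /-- the locale `𝕊^X` -/
  obj : Locale.{u}
  /-- the evaluation map `𝕊^X × X ⟶ 𝕊` -/
  ev : obj ⊗ X ⟶ sierpinski
  existsUnique_transpose : ∀ (A : Locale.{u}) (f : A ⊗ X ⟶ sierpinski),
    ∃! g : A ⟶ obj, g ▷ X ≫ ev = f

namespace SierpinskiPower

variable {X Y A : Locale.{u}}

/-- The exponential transpose `A ⟶ 𝕊^X` of a morphism `A × X ⟶ 𝕊`. -/
noncomputable def transpose (E : SierpinskiPower X) (f : A ⊗ X ⟶ sierpinski) : A ⟶ E.obj :=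
  (E.existsUnique_transpose A f).choose

/-- The morphism `A × X ⟶ 𝕊` whose exponential transpose is `g`. -/
def untranspose (E : SierpinskiPower X) (g : A ⟶ E.obj) : A ⊗ X ⟶ sierpinski :=
  g ▷ X ≫ E.ev

/-- The open of `A × X` classified by `g : A ⟶ 𝕊^X`. -/
def classified (E : SierpinskiPower X) (g : A ⟶ E.obj) : (A ⊗ X : Locale.{u}) :=
  opensEquiv _ (E.untranspose g)

/-- The morphism `𝕊^φ : 𝕊^X ⟶ 𝕊^Y` induced by `φ : Y ⟶ X`. -/
noncomputable def map (E : SierpinskiPower X) (F : SierpinskiPower Y) (φ : Y ⟶ X) :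
    E.obj ⟶ F.obj :=
  F.transpose (E.obj ◁ φ ≫ E.ev)

/-- The join `g ∨ h : A ⟶ 𝕊^X`, computed with the internal join operation of `𝕊`. -/
noncomputable def join (E : SierpinskiPower X) (g h : A ⟶ E.obj) : A ⟶ E.obj :=
  E.transpose (lift (E.untranspose g) (E.untranspose h) ≫ sierpinskiJoin)

/-- The point `⊥ : 1 ⟶ 𝕊^X`, the transpose of `1 × X ⟶ 1 ⟶ 𝕊`. -/
noncomputable def bot (E : SierpinskiPower X) : 𝟙_ Locale.{u} ⟶ E.obj :=
  E.transpose (toUnit (𝟙_ Locale.{u} ⊗ X) ≫ sierpinskiBot)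

end SierpinskiPower

/-- The morphism `X × X ⟶ 𝕊` classifying the closed diagonal of `X`. -/
def diagonalMap (X : Locale.{u}) : X ⊗ X ⟶ sierpinski :=
  (opensEquiv _).symm (diagonalCompl X)

/-- The morphism `i : X ⟶ 𝕊^X`, `x ↦ {x}`. -/
noncomputable def singletonMap {X : Locale.{u}} (E : SierpinskiPower X) : X ⟶ E.obj :=
  E.transpose (diagonalMap X)

/-- The morphism `d : 1 ⟶ 𝕊^(X × X)` picking out the closed diagonal. -/
noncomputable def diagonalPoint {X : Locale.{u}} (F : SierpinskiPower (X ⊗ X)) :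
    𝟙_ Locale.{u} ⟶ F.obj :=
  F.transpose ((λ_ (X ⊗ X)).hom ≫ diagonalMap X)

/-! ## Adjoints and inserters in the order-enriched category of locales -/

/-- `r` is right adjoint to `l`. -/
structure IsRightAdjointOf {P Q : Locale.{u}} (r : Q ⟶ P) (l : P ⟶ Q) : Prop where
  unit : 𝟙 P ≤ l ≫ r
  counit : r ≫ l ≤ 𝟙 Q

/-- `i : E ⟶ P` is the inserter of `g, f : P ⟶ Q`: the universal morphism to `P` whose composite
with `g` is less than or equal to its composite with `f`. -/
structure IsInserter {E P Q : Locale.{u}} (i : E ⟶ P) (g f : P ⟶ Q) : Prop where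
  condition : i ≫ g ≤ i ≫ f
  existsUnique_lift : ∀ (A : Locale.{u}) (h : A ⟶ P), h ≫ g ≤ h ≫ f → ∃! k : A ⟶ E, k ≫ i = h
  le_of_comp_le : ∀ (A : Locale.{u}) (k k' : A ⟶ E), k ≫ i ≤ k' ≫ i → k ≤ k'

end CompactHausdorffLocale

/-! A morphism `A ⟶ 𝕊^X` is an open `W` of `A × X`, thought of as a family of closed subsets of `X`
indexed by `A`. The inserter condition says that the members of the family have at most one point
(off-diagonal pairs lie in `W × X` or `X × W`) and are nonempty (the image of `W` along `A × X ⟶ A`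
is `⊥`); this is `IsGraphCompl`. Such a family should be a map `k : A ⟶ X`, with `k^* x` the largest
`a` over which the fibre lies in `x`, that is, `p_* (W ⊔ A × x)`. Finite meets are preserved because
`p_*` is a right adjoint, directed joins by compactness, the empty join by nonemptiness, and binary
joins because a fibre with at most one point inside `x ⊔ y` lies in `x` or in `y`
(`directImage_sup_le`).

Regularity of `X` (`le_sSup_wellInside`) then shows that the graph of `k` is the complement of `W`,
and that `k ≤ k'` can be tested on graphs. Every use of compactness goes through
`le_sSup_of_rect_top_le`, which computes the image along a projection from generating rectangles; in
particular it gives Beck–Chevalley, hence the adjoint `(𝕊^!)_*`. The exponential is built on Scott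
open sets; regularity and compactness make the lattice of opens continuous, which yields the
universal property. -/

namespace CompactHausdorffLocale

/-! ## Rectangles in products of locales -/

section Rectangles

variable {A B C : Locale.{u}}

/-- The open rectangle `a × b`. -/
def rect (a : A) (b : B) : (A ⊗ B : Locale.{u}) :=
  inverseImage (fst A B) a ⊓ inverseImage (snd A B) b

theorem rect_mono {a a' : A} {b b' : B} (ha : a ≤ a') (hb : b ≤ b') : rect a b ≤ rect a' b' :=
  inf_le_inf (OrderHomClass.mono _ ha) (OrderHomClass.mono _ hb)

theorem rect_top (a : A) : rect a (⊤ : B) = inverseImage (fst A B) a := by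
  simp [rect]

theorem rect_le_iff_mem (a : A) (b : B) (W : prodFrame A B) :
    rect a b ≤ (show (A ⊗ B : Locale.{u}) from W) ↔ (a, b) ∈ W.1 := by
  rw [← restrict_le_iff, ← prodInl_inf_prodInr]
  exact Iff.rfl

/-- Main tool for upper bounds: to control the rectangles inside a join of opens, a relation closed
under joins in each variable is realised as an open lying above all the generators. -/
theorem exists_open_of_closed (L : A → B → Prop)
    (mono : ∀ {a a' b b'}, a' ≤ a → b' ≤ b → L a b → L a' b')
    (left : ∀ (s : Set A) b, (∀ a ∈ s, L a b) → L (sSup s) b)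
    (right : ∀ a (t : Set B), (∀ b ∈ t, L a b) → L a (sSup t)) :
    ∃ W : (A ⊗ B : Locale.{u}), ∀ a b, rect a b ≤ W ↔ L a b :=
  ⟨(⟨⟨{p | L p.1 p.2}, fun _ _ h => mono h.1 h.2⟩, left, right⟩ : prodFrame A B),
    fun a b => rect_le_iff_mem a b _⟩

theorem open_le_iff (W V : (A ⊗ B : Locale.{u})) :
    W ≤ V ↔ ∀ a b, rect a b ≤ W → rect a b ≤ V := by
  refine ⟨fun h a b hab => hab.trans h, fun h => ?_⟩
  intro p hp
  exact (rect_le_iff_mem p.1 p.2 V).1 (h _ _ ((rect_le_iff_mem p.1 p.2 W).2 hp))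

theorem rect_sSup_left_le {s : Set A} {b : B} {W : (A ⊗ B : Locale.{u})}
    (h : ∀ a ∈ s, rect a b ≤ W) : rect (sSup s) b ≤ W :=
  (rect_le_iff_mem _ _ W).2 (W.2.1 s b fun a ha => (rect_le_iff_mem a b W).1 (h a ha))

theorem rect_sSup_right_le {a : A} {t : Set B} {W : (A ⊗ B : Locale.{u})}
    (h : ∀ b ∈ t, rect a b ≤ W) : rect a (sSup t) ≤ W :=
  (rect_le_iff_mem _ _ W).2 (W.2.2 a t fun b hb => (rect_le_iff_mem a b W).1 (h b hb))

theorem rect_sup_right_le {a : A} {b b' : B} {W : (A ⊗ B : Locale.{u})}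
    (h : rect a b ≤ W) (h' : rect a b' ≤ W) : rect a (b ⊔ b') ≤ W := by
  rw [← sSup_pair]
  refine rect_sSup_right_le ?_
  rintro _ (rfl | rfl) <;> assumption

theorem rect_bot_le (a : A) (W : (A ⊗ B : Locale.{u})) : rect a ⊥ ≤ W := by
  rw [← sSup_empty]
  exact rect_sSup_right_le (by simp)

theorem inverseImage_rect (f : C ⟶ A ⊗ B) (a : A) (b : B) :
    inverseImage f (rect a b) = inverseImage (f ≫ fst A B) a ⊓ inverseImage (f ≫ snd A B) b := by
  rw [rect, map_inf]
  rfl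

theorem inverseImage_le_iff (f : C ⟶ A ⊗ B) (W : (A ⊗ B : Locale.{u})) (c : C) :
    inverseImage f W ≤ c ↔ ∀ a b, rect a b ≤ W → inverseImage f (rect a b) ≤ c := by
  refine ⟨fun h a b hab => (OrderHomClass.mono _ hab).trans h, fun h => ?_⟩
  rw [← le_directImage_iff, open_le_iff]
  intro a b hab
  rw [le_directImage_iff]
  exact h a b hab

theorem inverseImage_whiskerRight_rect {D : Locale.{u}} (f : C ⟶ A) (a : A) (d : D) :
    inverseImage (f ▷ D) (rect a d) = rect (inverseImage f a) d := by
  rw [inverseImage_rect, whiskerRight_fst, whiskerRight_snd]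
  rfl

theorem inverseImage_whiskerLeft_rect {D : Locale.{u}} (f : C ⟶ A) (d : D) (a : A) :
    inverseImage (D ◁ f) (rect d a) = rect d (inverseImage f a) := by
  rw [inverseImage_rect, whiskerLeft_fst, whiskerLeft_snd]
  rfl

theorem inverseImage_diagonal_rect (a b : A) : inverseImage (diagonal A) (rect a b) = a ⊓ b := by
  rw [inverseImage_rect, diagonal, lift_fst, lift_snd]
  rfl

theorem rect_le_diagonalCompl {a b : A} : rect a b ≤ diagonalCompl A ↔ a ⊓ b = ⊥ := by
  rw [diagonalCompl, le_directImage_iff, inverseImage_diagonal_rect, le_bot_iff]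

theorem inverseImage_diagonal_diagonalCompl :
    inverseImage (diagonal A) (diagonalCompl A) = ⊥ :=
  le_bot_iff.1 ((le_directImage_iff _ _ _).1 le_rfl)

theorem hom_le_iff (f g : C ⟶ A ⊗ B) :
    f ≤ g ↔ f ≫ fst A B ≤ g ≫ fst A B ∧ f ≫ snd A B ≤ g ≫ snd A B := by
  refine ⟨fun h => ⟨fun v => h _, fun v => h _⟩, fun h W => ?_⟩
  rw [inverseImage_le_iff]
  intro a b hab
  refine le_trans ?_ (OrderHomClass.mono (inverseImage g) hab)
  rw [inverseImage_rect, inverseImage_rect]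
  exact inf_le_inf (h.1 a) (h.2 b)

end Rectangles

theorem comp_le_comp {A B C : Locale.{u}} {f f' : A ⟶ B} {g g' : B ⟶ C} (hf : f ≤ f')
    (hg : g ≤ g') : f ≫ g ≤ f' ≫ g' := fun v =>
  (hf (inverseImage g v)).trans (OrderHomClass.mono (inverseImage f') (hg v))

/-! ## Compactness and projections -/

section Compact

variable {A B C : Locale.{u}}

theorem IsCompactLocale.exists_finset (hB : IsCompactLocale B) {t : Set B} (ht : sSup t = ⊤) :
    ∃ F : Finset B, ↑F ⊆ t ∧ F.sup id = ⊤ := by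
  classical
  have := hB ((fun F : Finset B => F.sup id) '' {F | ↑F ⊆ t}) ⟨_, ∅, by simp, rfl⟩ ?_ ?_
  · obtain ⟨F, hF, h⟩ := this
    exact ⟨F, hF, h⟩
  · rintro _ ⟨F, hF, rfl⟩ _ ⟨G, hG, rfl⟩
    refine ⟨_, ⟨F ∪ G, ?_, rfl⟩, Finset.sup_mono Finset.subset_union_left,
      Finset.sup_mono Finset.subset_union_right⟩
    simpa using ⟨hF, hG⟩
  · rw [eq_top_iff, ← ht]
    refine sSup_le fun b hb => le_sSup ⟨{b}, by simpa using hb, by simp⟩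

/-- Opens of `A × B` generated by a relation closed under finite joins in the second variable,
with `B` compact: the largest `a` with `a × B` below them. -/
theorem IsCompactLocale.le_sSup_of_rect_top_le (hB : IsCompactLocale B) (L : A → B → Prop)
    (bot : ∀ a, L a ⊥)
    (sup : ∀ {a a' b b'}, L a b → L a' b' → L (a ⊓ a') (b ⊔ b'))
    {W : (A ⊗ B : Locale.{u})}
    (hW : ∀ V : (A ⊗ B : Locale.{u}), (∀ a b, L a b → rect a b ≤ V) → W ≤ V)
    {a : A} (ha : rect a ⊤ ≤ W) : a ≤ sSup {a' | L a' ⊤} := by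
  classical
  -- The auxiliary `c` lets a cover be treated one member at a time: whatever `c` completes `b` to a
  -- cover, `a` must be covered by opens related to some `b'` that also completes `c`. The claim is
  -- the case `b = ⊤`, `c = ⊥`.
  obtain ⟨V, hV⟩ := exists_open_of_closed (A := A) (B := B)
    (fun a b => ∀ c, b ⊔ c = ⊤ → a ≤ sSup {a' | ∃ b', L a' b' ∧ b' ⊔ c = ⊤})
    (fun ha hb h c hc => ha.trans (h c (top_le_iff.1 (hc.ge.trans (sup_le_sup_right hb c)))))
    (fun s b h c hc => sSup_le fun a ha => h a ha c hc)
    (by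
      intro a t h c hc
      have hc' : sSup (insert c t) = ⊤ := by rw [sSup_insert, sup_comm, hc]
      obtain ⟨F, hF, hF'⟩ := hB.exists_finset hc'
      -- One member `b` of the cover is traded for a related `b'`, which is absorbed into `d` before
      -- the induction hypothesis handles the rest; `sup` merges the two trades.
      have key : ∀ G : Finset B, (∀ b ∈ G, b ∈ t) → ∀ d, G.sup id ⊔ d = ⊤ →
          a ≤ sSup {a' | ∃ b', L a' b' ∧ b' ⊔ d = ⊤} := by
        intro G
        induction G using Finset.induction_on with
        | empty =>
          intro _ d hd
          exact le_sSup ⟨⊥, bot a, by simpa using hd⟩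
        | insert b G _ ih =>
          intro hG d hd
          rw [Finset.sup_insert, id, sup_assoc] at hd
          have h₁ := h b (hG b (by simp)) _ hd
          rw [← inf_eq_left.2 h₁, inf_sSup_eq]
          refine iSup₂_le ?_
          rintro a' ⟨b', hL, hb'⟩
          have h₂ := ih (fun x hx => hG x (Finset.mem_insert_of_mem hx)) (b' ⊔ d) (by
            rw [← hb']; ac_rfl)
          refine (inf_le_inf_right _ h₂).trans ?_
          rw [sSup_inf_eq]
          refine iSup₂_le ?_
          rintro a'' ⟨b'', hL', hb''⟩
          exact le_sSup ⟨b'' ⊔ b', sup hL' hL, by rw [← hb'']; ac_rfl⟩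
      -- The finite subcover may use `c`, which need not belong to `t`; it is removed and kept as
      -- the parameter.
      refine key (F.erase c) (fun b hb => ?_) c ?_
      · rw [Finset.mem_erase] at hb
        exact (hF hb.2).resolve_left hb.1
      · rw [eq_top_iff, ← hF', Finset.sup_le_iff]
        intro b hb
        by_cases hbc : b = c
        · exact hbc ▸ le_sup_right
        · exact le_sup_of_le_left (Finset.le_sup (f := id) (Finset.mem_erase.2 ⟨hbc, hb⟩)))
  have h₁ : W ≤ V := hW V fun a b hL => (hV a b).2 fun c hc => le_sSup ⟨b, hL, hc⟩
  simpa using (hV a ⊤).1 (ha.trans h₁) ⊥ (by simp)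

theorem rect_top_le_iff {a : A} {W : (A ⊗ B : Locale.{u})} :
    rect a ⊤ ≤ W ↔ a ≤ directImage (fst A B) W := by
  rw [le_directImage_iff, rect_top]

/-- The rectangles contained in some member of `s` generate `sSup s`, and directedness makes this
relation closed under finite joins in the compact variable. -/
theorem IsCompactLocale.directImage_fst_sSup (hB : IsCompactLocale B)
    {s : Set (A ⊗ B : Locale.{u})} (hs : s.Nonempty) (hd : DirectedOn (· ≤ ·) s) :
    directImage (fst A B) (sSup s) = sSup (directImage (fst A B) '' s) := by
  refine le_antisymm ?_ (sSup_le ?_)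
  · refine (hB.le_sSup_of_rect_top_le (fun a b => ∃ W ∈ s, rect a b ≤ W) ?_ ?_ ?_
      (rect_top_le_iff.2 le_rfl)).trans (sSup_le ?_)
    · intro a
      obtain ⟨W, hW⟩ := hs
      exact ⟨W, hW, rect_bot_le _ _⟩
    · rintro a a' b b' ⟨W, hW, h⟩ ⟨W', hW', h'⟩
      obtain ⟨V, hV, hWV, hWV'⟩ := hd W hW W' hW'
      exact ⟨V, hV, rect_sup_right_le ((rect_mono inf_le_left le_rfl).trans (h.trans hWV))
        ((rect_mono inf_le_right le_rfl).trans (h'.trans hWV'))⟩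
    · intro V hV
      refine sSup_le fun W hW => (open_le_iff _ _).2 fun a b hab => hV a b ⟨W, hW, hab⟩
    · rintro a ⟨W, hW, h⟩
      exact (rect_top_le_iff.1 h).trans (le_sSup ⟨W, hW, rfl⟩)
  · rintro _ ⟨W, hW, rfl⟩
    rw [← rect_top_le_iff]
    exact (rect_top_le_iff.2 le_rfl).trans (le_sSup hW)

/-- Beck–Chevalley for the projection away from a compact locale. -/
theorem IsCompactLocale.directImage_fst_whiskerRight (hB : IsCompactLocale B) (f : C ⟶ A)
    (W : (A ⊗ B : Locale.{u})) :
    directImage (fst C B) (inverseImage (f ▷ B) W) = inverseImage f (directImage (fst A B) W) := by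
  refine le_antisymm ?_ ?_
  -- The pullback of `W` is generated by the pullbacks of rectangles in `W`, so only those with
  -- second side `⊤` matter.
  · refine (hB.le_sSup_of_rect_top_le (fun c b => ∃ a, c ≤ inverseImage f a ∧ rect a b ≤ W)
      ?_ ?_ ?_ (rect_top_le_iff.2 le_rfl)).trans (sSup_le ?_)
    · exact fun c => ⟨⊤, by simp, rect_bot_le _ _⟩
    · rintro c c' b b' ⟨a, h₁, h₂⟩ ⟨a', h₁', h₂'⟩
      refine ⟨a ⊓ a', ?_, rect_sup_right_le ((rect_mono inf_le_left le_rfl).trans h₂)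
        ((rect_mono inf_le_right le_rfl).trans h₂')⟩
      rw [map_inf]
      exact inf_le_inf h₁ h₁'
    · intro V hV
      rw [inverseImage_le_iff]
      intro a b hab
      rw [inverseImage_whiskerRight_rect]
      exact hV _ _ ⟨a, le_rfl, hab⟩
    · rintro c ⟨a, h₁, h₂⟩
      exact h₁.trans (OrderHomClass.mono _ (rect_top_le_iff.1 h₂))
  · rw [← rect_top_le_iff, ← inverseImage_whiskerRight_rect]
    exact OrderHomClass.mono _ (rect_top_le_iff.2 le_rfl)

theorem IsCompactLocale.prod (hA : IsCompactLocale A) (hB : IsCompactLocale B) :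
    IsCompactLocale (A ⊗ B) := by
  intro s hs hd htop
  have h := hB.directImage_fst_sSup hs hd
  rw [htop] at h
  have h₁ : directImage (fst A B) ⊤ = ⊤ :=
    top_le_iff.1 ((le_directImage_iff _ _ _).2 le_top)
  rw [h₁] at h
  obtain ⟨W, hW, hW'⟩ := hA _ (hs.image _) (by
    rintro _ ⟨W, hW, rfl⟩ _ ⟨W', hW', rfl⟩
    obtain ⟨V, hV, h₁, h₂⟩ := hd W hW W' hW'
    exact ⟨_, ⟨V, hV, rfl⟩, rect_top_le_iff.1 ((rect_top_le_iff.2 le_rfl).trans h₁),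
      rect_top_le_iff.1 ((rect_top_le_iff.2 le_rfl).trans h₂)⟩) h.symm
  have h₂ : W = ⊤ := by
    have := (le_directImage_iff _ _ _).1 hW'.ge
    rwa [map_top, top_le_iff] at this
  exact h₂ ▸ hW

theorem isCompactLocale_point : IsCompactLocale (𝟙_ Locale.{u}) := by
  intro s hs _ h
  by_contra hn
  have hs : ∀ U ∈ s, U = (⊥ : Set PUnit.{u + 1}) := fun (U : Set PUnit.{u + 1}) hU => by
    by_contra hU'
    obtain ⟨x, hx⟩ := Set.nonempty_iff_ne_empty.2 hU'
    have : U = (⊤ : Set PUnit.{u + 1}) := Set.eq_univ_of_forall fun y => hx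
    exact hn (this ▸ hU)
  have h₁ : sSup s ≤ (⊥ : Set PUnit.{u + 1}) := sSup_le fun U hU => (hs U hU).le
  rw [h] at h₁
  exact h₁ (Set.mem_univ PUnit.unit)

/-- By excluded middle, the relation `x ≤ a ∨ y ≤ b` is closed under joins in each variable, so it
defines an open containing both strips. -/
theorem eq_top_or_eq_top_of_sup_eq_top {a : A} {b : B}
    (h : (inverseImage (fst A B) a ⊔ inverseImage (snd A B) b) = ⊤) : a = ⊤ ∨ b = ⊤ := by
  obtain ⟨V, hV⟩ := exists_open_of_closed (A := A) (B := B) (fun x y => x ≤ a ∨ y ≤ b)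
    (fun ha hb h => h.imp ha.trans hb.trans)
    (fun s y h => by
      by_cases hy : y ≤ b
      · exact Or.inr hy
      · exact Or.inl (sSup_le fun x hx => (h x hx).resolve_right hy))
    (fun x t h => by
      by_cases hx : x ≤ a
      · exact Or.inl hx
      · exact Or.inr (sSup_le fun y hy => (h y hy).resolve_left hx))
  have h₁ : inverseImage (fst A B) a ≤ V := by
    rw [← rect_top, hV]; exact Or.inl le_rfl
  have h₂ : inverseImage (snd A B) b ≤ V := by
    have : inverseImage (snd A B) b = rect ⊤ b := by simp [rect]
    rw [this, hV]; exact Or.inr le_rfl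
  have h₃ := (hV ⊤ ⊤).1 (le_top.trans (h.ge.trans (sup_le h₁ h₂)))
  exact h₃.imp top_le_iff.1 top_le_iff.1

end Compact

/-! ## Hausdorff locales -/

section Hausdorff

variable {A B X Y : Locale.{u}}

theorem IsHausdorffLocale.directImage_diagonal (hX : IsHausdorffLocale X)
    (v : (X ⊗ X : Locale.{u})) :
    directImage (diagonal X) (inverseImage (diagonal X) v) = v ⊔ diagonalCompl X := by
  have h := hX.frobenius v ⊥
  rwa [sup_bot_eq] at h

theorem inverseImage_diagonal_fst (a : X) :
    inverseImage (diagonal X) (inverseImage (fst X X) a) = a := by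
  rw [← rect_top, inverseImage_diagonal_rect, inf_top_eq]

theorem inverseImage_diagonal_snd (a : X) :
    inverseImage (diagonal X) (inverseImage (snd X X) a) = a := by
  rw [← inverseImage_comp, diagonal, lift_snd]
  rfl

theorem IsHausdorffLocale.fst_le (hX : IsHausdorffLocale X) (a : X) :
    inverseImage (fst X X) a ≤ inverseImage (snd X X) a ⊔ diagonalCompl X := by
  rw [← hX.directImage_diagonal, le_directImage_iff, inverseImage_diagonal_fst,
    inverseImage_diagonal_snd]

theorem IsHausdorffLocale.snd_le (hX : IsHausdorffLocale X) (a : X) :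
    inverseImage (snd X X) a ≤ inverseImage (fst X X) a ⊔ diagonalCompl X := by
  rw [← hX.directImage_diagonal, le_directImage_iff, inverseImage_diagonal_fst,
    inverseImage_diagonal_snd]

/-- Modulo the complement of the diagonal the two coordinates agree, which gives the explicit
formula `key` for the direct image; both clauses of properness follow from it. This criterion is
easy to check on products. -/
theorem isHausdorffLocale_of_le
    (h₁ : ∀ a, inverseImage (fst X X) a ≤ inverseImage (snd X X) a ⊔ diagonalCompl X)
    (h₂ : ∀ a, inverseImage (snd X X) a ≤ inverseImage (fst X X) a ⊔ diagonalCompl X) :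
    IsHausdorffLocale X := by
  have key : ∀ c, directImage (diagonal X) c = inverseImage (fst X X) c ⊔ diagonalCompl X := by
    intro c
    refine le_antisymm ((open_le_iff _ _).2 fun p q hpq => ?_) (sup_le ?_ ?_)
    · rw [le_directImage_iff, inverseImage_diagonal_rect] at hpq
      refine (inf_le_inf_left _ (h₂ q)).trans ?_
      rw [inf_sup_left, ← map_inf]
      exact sup_le_sup (OrderHomClass.mono _ hpq) inf_le_right
    · rw [le_directImage_iff, inverseImage_diagonal_fst]
    · rw [le_directImage_iff, inverseImage_diagonal_diagonalCompl]
      exact bot_le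
  refine ⟨fun s hs _ => ?_, fun v a => ?_⟩
  · rw [key, map_sSup, sSup_image', sSup_image', @iSup_sup _ _ _ hs.to_subtype]
    simp only [key]
  · rw [key, key, map_sup]
    refine le_antisymm (sup_le (sup_le ?_ (le_sup_of_le_right le_sup_left))
      (le_sup_of_le_right le_sup_right)) ?_
    · rw [← inverseImage_comp, inverseImage_le_iff]
      intro p q hpq
      rw [inverseImage_comp, inverseImage_diagonal_rect, map_inf]
      refine (inf_le_inf_left _ (h₁ q)).trans ?_
      rw [inf_sup_left]
      exact sup_le (le_sup_of_le_left hpq) (inf_le_right.trans (le_sup_of_le_right le_sup_right))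
    · refine sup_le ?_ (sup_le_sup_right le_sup_right _)
      have : v ≤ directImage (diagonal X) (inverseImage (diagonal X) v) :=
        (le_directImage_iff _ _ _).2 le_rfl
      rw [key] at this
      exact this.trans (sup_le_sup_right le_sup_left _)

/-- The map `f × f` carries the diagonal into the diagonal. -/
theorem inverseImage_diagonalCompl_le (f : Y ⟶ X) :
    inverseImage (lift (fst Y Y ≫ f) (snd Y Y ≫ f)) (diagonalCompl X) ≤ diagonalCompl Y := by
  refine (le_directImage_iff _ _ _).2 ?_
  rw [← inverseImage_comp]
  have : diagonal Y ≫ lift (fst Y Y ≫ f) (snd Y Y ≫ f) = f ≫ diagonal X := by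
    simp [diagonal]
  rw [this, inverseImage_comp, inverseImage_diagonal_diagonalCompl, map_bot]

theorem IsHausdorffLocale.fst_inverseImage_le (hX : IsHausdorffLocale X) (f : Y ⟶ X) (a : X) :
    inverseImage (fst Y Y) (inverseImage f a) ≤
      inverseImage (snd Y Y) (inverseImage f a) ⊔ diagonalCompl Y := by
  have h := OrderHomClass.mono (inverseImage (lift (fst Y Y ≫ f) (snd Y Y ≫ f))) (hX.fst_le a)
  rw [map_sup, ← inverseImage_comp, ← inverseImage_comp, lift_fst, lift_snd] at h
  exact h.trans (sup_le_sup_left (inverseImage_diagonalCompl_le f) _)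

theorem IsHausdorffLocale.snd_inverseImage_le (hX : IsHausdorffLocale X) (f : Y ⟶ X) (a : X) :
    inverseImage (snd Y Y) (inverseImage f a) ≤
      inverseImage (fst Y Y) (inverseImage f a) ⊔ diagonalCompl Y := by
  have h := OrderHomClass.mono (inverseImage (lift (fst Y Y ≫ f) (snd Y Y ≫ f))) (hX.snd_le a)
  rw [map_sup, ← inverseImage_comp, ← inverseImage_comp, lift_fst, lift_snd] at h
  exact h.trans (sup_le_sup_left (inverseImage_diagonalCompl_le f) _)

theorem IsHausdorffLocale.prod (hX : IsHausdorffLocale X) (hY : IsHausdorffLocale Y) :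
    IsHausdorffLocale (X ⊗ Y) := by
  -- The opens satisfying the inequality are determined by rectangles, so it need only be known for
  -- opens pulled back from each factor.
  have aux : ∀ (p q : (X ⊗ Y) ⊗ (X ⊗ Y) ⟶ X ⊗ Y) (N : ((X ⊗ Y) ⊗ (X ⊗ Y) : Locale.{u})),
      (∀ x, inverseImage p (inverseImage (fst X Y) x) ≤
        inverseImage q (inverseImage (fst X Y) x) ⊔ N) →
      (∀ y, inverseImage p (inverseImage (snd X Y) y) ≤
        inverseImage q (inverseImage (snd X Y) y) ⊔ N) →
      ∀ W, inverseImage p W ≤ inverseImage q W ⊔ N := by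
    intro p q N h₁ h₂ W
    rw [inverseImage_le_iff]
    intro x y hxy
    refine le_trans ?_ (sup_le_sup_right (OrderHomClass.mono _ hxy) N)
    rw [inverseImage_rect, inverseImage_rect, sup_inf_right]
    exact inf_le_inf (h₁ x) (h₂ y)
  exact isHausdorffLocale_of_le
    (aux _ _ _ (hX.fst_inverseImage_le (fst X Y)) (hY.fst_inverseImage_le (snd X Y)))
    (aux _ _ _ (hX.snd_inverseImage_le (fst X Y)) (hY.snd_inverseImage_le (snd X Y)))

theorem isHausdorffLocale_point : IsHausdorffLocale (𝟙_ Locale.{u}) := by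
  have h : fst (𝟙_ Locale.{u}) (𝟙_ Locale.{u}) = snd _ _ := toUnit_unique _ _
  exact isHausdorffLocale_of_le (fun a => by rw [h]; exact le_sup_left)
    (fun a => by rw [h]; exact le_sup_left)

/-- Compact Hausdorff locales are regular. -/
theorem IsCompactHausdorff.le_sSup_wellInside (hX : IsCompactHausdorff X) (a : X) :
    a ≤ sSup {b | ∃ z, b ⊓ z = ⊥ ∧ z ⊔ a = ⊤} := by
  -- By `fst_le`, `a × X` lies in the union of `X × a` and the complement of the diagonal. That
  -- union is generated by rectangles `x × y` with `y ≤ z ⊔ a` for some `z` disjoint from `x`; when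
  -- `y = ⊤` this says that `x` is well inside `a`.
  refine (hX.compact.le_sSup_of_rect_top_le (A := X)
    (W := inverseImage (snd X X) a ⊔ diagonalCompl X)
    (fun x y => ∃ z, x ⊓ z = ⊥ ∧ y ≤ z ⊔ a) ?_ ?_ ?_ ?_).trans (sSup_le ?_)
  · exact fun x => ⟨⊥, by simp, bot_le⟩
  · rintro x x' y y' ⟨z, h₁, h₂⟩ ⟨z', h₁', h₂'⟩
    refine ⟨z ⊔ z', ?_, sup_le (h₂.trans (sup_le_sup_right le_sup_left a))
      (h₂'.trans (sup_le_sup_right le_sup_right a))⟩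
    rw [inf_sup_left, ← le_bot_iff]
    exact sup_le ((inf_le_inf_right _ inf_le_left).trans h₁.le)
      ((inf_le_inf_right _ inf_le_right).trans h₁'.le)
  · intro V hV
    refine sup_le ?_ ((open_le_iff _ _).2 fun x y hxy => ?_)
    · have : inverseImage (snd X X) a = rect ⊤ a := by simp [rect]
      rw [this]
      exact hV _ _ ⟨⊥, by simp, by simp⟩
    · exact hV _ _ ⟨y, rect_le_diagonalCompl.1 hxy, le_sup_left⟩
  · rw [rect_top]
    exact hX.hausdorff.fst_le a
  · rintro b ⟨z, h₁, h₂⟩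
    exact le_sSup ⟨z, h₁, top_le_iff.1 h₂⟩

theorem IsCompactHausdorff.prod (hX : IsCompactHausdorff X) (hY : IsCompactHausdorff Y) :
    IsCompactHausdorff (X ⊗ Y) :=
  ⟨hX.compact.prod hY.compact, hX.hausdorff.prod hY.hausdorff⟩

theorem isCompactHausdorff_point : IsCompactHausdorff (𝟙_ Locale.{u}) :=
  ⟨isCompactLocale_point, isHausdorffLocale_point⟩

end Hausdorff

/-! ## Existence of exponentials -/

section Exponential

variable {A X : Locale.{u}}

/-- The Scott topology on the frame of opens of `X`. -/
instance scottTopology (X : Locale.{u}) : TopologicalSpace X where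
  IsOpen S := IsUpperSet S ∧
    ∀ D : Set X, D.Nonempty → DirectedOn (· ≤ ·) D → sSup D ∈ S → ∃ d ∈ D, d ∈ S
  isOpen_univ := ⟨isUpperSet_univ, fun _ ⟨d, hd⟩ _ _ => ⟨d, hd, trivial⟩⟩
  isOpen_inter S T hS hT := by
    refine ⟨hS.1.inter hT.1, fun D hD hdir h => ?_⟩
    obtain ⟨d, hd, hdS⟩ := hS.2 D hD hdir h.1
    obtain ⟨e, he, heT⟩ := hT.2 D hD hdir h.2
    obtain ⟨c, hc, hdc, hec⟩ := hdir d hd e he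
    exact ⟨c, hc, hS.1 hdc hdS, hT.1 hec heT⟩
  isOpen_sUnion s hs := by
    refine ⟨isUpperSet_sUnion fun S hS => (hs S hS).1, fun D hD hdir h => ?_⟩
    obtain ⟨S, hS, hDS⟩ := h
    obtain ⟨d, hd, hdS⟩ := (hs S hS).2 D hD hdir hDS
    exact ⟨d, hd, S, hS, hdS⟩

/-- The frame of Scott open sets of opens of `X`. -/
abbrev ScottOpens (X : Locale.{u}) : Type u := TopologicalSpace.Opens X

theorem ScottOpens.upper (S : ScottOpens X) {a b : X} (hab : a ≤ b) (ha : a ∈ S) : b ∈ S :=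
  (show IsUpperSet S.1 from S.2.1) hab ha

theorem ScottOpens.exists_mem (S : ScottOpens X) {D : Set X} (hD : D.Nonempty)
    (hdir : DirectedOn (· ≤ ·) D) (h : sSup D ∈ S) : ∃ d ∈ D, d ∈ S :=
  S.2.2 D hD hdir h

theorem ScottOpens.exists_finset (S : ScottOpens X) {t : Set X} (ht : sSup t ∈ S) :
    ∃ F : Finset X, ↑F ⊆ t ∧ F.sup id ∈ S := by
  classical
  have := S.exists_mem (D := (fun F : Finset X => F.sup id) '' {F | ↑F ⊆ t})
    ⟨_, ∅, by simp, rfl⟩ ?_ ?_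
  · obtain ⟨_, ⟨F, hF, rfl⟩, h⟩ := this
    exact ⟨F, hF, h⟩
  · rintro _ ⟨F, hF, rfl⟩ _ ⟨G, hG, rfl⟩
    refine ⟨_, ⟨F ∪ G, ?_, rfl⟩, Finset.sup_mono Finset.subset_union_left,
      Finset.sup_mono Finset.subset_union_right⟩
    simpa using ⟨hF, hG⟩
  · refine S.upper ?_ ht
    exact sSup_le fun b hb => le_sSup ⟨{b}, by simpa using hb, by simp⟩

/-- The Scott open set of the `b` with `a ⊔ b ∈ S`. -/
def ScottOpens.supPreimage (S : ScottOpens X) (a : X) : ScottOpens X :=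
  ⟨{b | a ⊔ b ∈ S}, fun _ _ h hb => S.upper (sup_le_sup_left h a) hb, fun D hD hdir h => by
    obtain ⟨_, ⟨d, hd, rfl⟩, hS⟩ := S.exists_mem (D := (a ⊔ ·) '' D) (hD.image _)
      (by
        rintro _ ⟨d, hd, rfl⟩ _ ⟨e, he, rfl⟩
        obtain ⟨c, hc, h₁, h₂⟩ := hdir d hd e he
        exact ⟨_, ⟨c, hc, rfl⟩, sup_le_sup_left h₁ a, sup_le_sup_left h₂ a⟩)
      (by
        refine S.upper (sup_le ?_ (sSup_le fun d hd => ?_)) h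
        · obtain ⟨d, hd⟩ := hD
          exact le_trans le_sup_left (le_sSup ⟨d, hd, rfl⟩)
        · exact le_trans le_sup_right (le_sSup ⟨d, hd, rfl⟩))
    exact ⟨d, hd, hS⟩⟩

/-- The opens in which `b` is well inside form a Scott open set when `X` is compact. -/
def wellInsideOpens (hX : IsCompactLocale X) (b : X) : ScottOpens X :=
  ⟨{c | ∃ z, b ⊓ z = ⊥ ∧ z ⊔ c = ⊤},
    fun _ _ hcd ⟨z, h₁, h₂⟩ => ⟨z, h₁, top_le_iff.1 (h₂.ge.trans (sup_le_sup_left hcd z))⟩,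
    fun D hD hdir ⟨z, h₁, h₂⟩ => by
      obtain ⟨d, hd, h⟩ := hX ((z ⊔ ·) '' D) (hD.image _)
        (by
          rintro _ ⟨d, hd, rfl⟩ _ ⟨e, he, rfl⟩
          obtain ⟨c, hc, h₁, h₂⟩ := hdir d hd e he
          exact ⟨_, ⟨c, hc, rfl⟩, sup_le_sup_left h₁ z, sup_le_sup_left h₂ z⟩)
        (by
          rw [eq_top_iff, ← h₂]
          refine sup_le ?_ (sSup_le fun d hd => ?_)
          · obtain ⟨d, hd⟩ := hD
            exact le_trans le_sup_left (le_sSup ⟨d, hd, rfl⟩)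
          · exact le_trans le_sup_right (le_sSup ⟨d, hd, rfl⟩))
      exact ⟨d, hd, z, h₁, h⟩⟩

theorem le_of_mem_wellInsideOpens {hX : IsCompactLocale X} {b c : X}
    (h : c ∈ wellInsideOpens hX b) : b ≤ c := by
  obtain ⟨z, h₁, h₂⟩ := h
  have : b ≤ b ⊓ (z ⊔ c) := by rw [h₂, inf_top_eq]
  rw [inf_sup_left, h₁, bot_sup_eq] at this
  exact this.trans inf_le_right

theorem IsCompactHausdorff.sSup_wellInside (hX : IsCompactHausdorff X) (c : X) :
    sSup {b | c ∈ wellInsideOpens hX.compact b} = c :=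
  le_antisymm (sSup_le fun _ h => le_of_mem_wellInsideOpens (hX := hX.compact) h)
    (hX.le_sSup_wellInside c)

/-- By regularity `c` is the directed join of the opens well inside it, and a Scott open set
containing a directed join contains a member. -/
theorem IsCompactHausdorff.exists_mem_wellInside (hX : IsCompactHausdorff X) (S : ScottOpens X)
    {c : X} (hc : c ∈ S) : ∃ b ∈ S, c ∈ wellInsideOpens hX.compact b := by
  have hdir : DirectedOn (· ≤ ·) {b | c ∈ wellInsideOpens hX.compact b} := by
    rintro b ⟨z, h₁, h₂⟩ b' ⟨z', h₁', h₂'⟩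
    refine ⟨b ⊔ b', ⟨z ⊓ z', ?_, ?_⟩, le_sup_left, le_sup_right⟩
    · rw [inf_sup_right, ← le_bot_iff]
      exact sup_le ((inf_le_inf_left _ inf_le_left).trans h₁.le)
        ((inf_le_inf_left _ inf_le_right).trans h₁'.le)
    · rw [sup_inf_right, h₂, h₂', inf_top_eq]
  have hbot : c ∈ wellInsideOpens hX.compact ⊥ := ⟨⊤, by simp, by simp⟩
  obtain ⟨b, hb, hbS⟩ := S.exists_mem (D := {b | c ∈ wellInsideOpens hX.compact b}) ⟨⊥, hbot⟩ hdir
    (by rwa [hX.sSup_wellInside])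
  exact ⟨b, hbS, hb⟩

/-- Continuity of the lattice of opens: the sets `wellInsideOpens` form a base of the Scott
topology. -/
theorem IsCompactHausdorff.eq_sSup_wellInsideOpens (hX : IsCompactHausdorff X)
    (S : ScottOpens X) : S = sSup (wellInsideOpens hX.compact '' {b | b ∈ S}) := by
  refine le_antisymm (fun c hc => ?_) (sSup_le ?_)
  · obtain ⟨b, hb, hbc⟩ := hX.exists_mem_wellInside S hc
    exact TopologicalSpace.Opens.mem_sSup.2 ⟨_, ⟨b, hb, rfl⟩, hbc⟩
  · rintro _ ⟨b, hb, rfl⟩ c hc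
    exact S.upper (le_of_mem_wellInsideOpens hc) hb

/-- The locale `𝕊^X`: its opens are the Scott open sets of opens of `X`. -/
def powerLocale (X : Locale.{u}) : Locale.{u} := Locale.of (ScottOpens X)

theorem exists_evOpen (X : Locale.{u}) : ∃ W : (powerLocale X ⊗ X : Locale.{u}),
    ∀ (S : ScottOpens X) (b : X),
      rect (A := powerLocale X) S b ≤ W ↔ ∀ c ∈ S, b ≤ c :=
  exists_open_of_closed (A := powerLocale X) (B := X)
    (fun (S : ScottOpens X) b => ∀ c ∈ S, b ≤ c)
    (fun {_ _ _ _} hS hb h c hc => hb.trans (h c (hS hc)))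
    (fun _ _ h c hc => by
      obtain ⟨S, hS, hcS⟩ := TopologicalSpace.Opens.mem_sSup.1 hc
      exact h S hS c hcS)
    (fun _ _ h c hc => sSup_le fun b hb => h b hb c hc)

/-- The open of `𝕊^X × X` classified by evaluation. -/
noncomputable def evOpen (X : Locale.{u}) : (powerLocale X ⊗ X : Locale.{u}) :=
  (exists_evOpen X).choose

theorem rect_le_evOpen (S : ScottOpens X) (b : X) :
    rect (A := powerLocale X) S b ≤ evOpen X ↔ ∀ c ∈ S, b ≤ c :=
  (exists_evOpen X).choose_spec S b

/-- The inverse image map of the morphism `A ⟶ 𝕊^X` classifying `W`. -/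
def powerDesc (W : (A ⊗ X : Locale.{u})) : FrameHom (ScottOpens X) A where
  toFun S := sSup {a | ∃ b ∈ S, rect a b ≤ W}
  map_inf' S T := by
    refine le_antisymm (le_inf ?_ ?_) ?_
    · exact sSup_le_sSup fun a ⟨b, hb, h⟩ => ⟨b, hb.1, h⟩
    · exact sSup_le_sSup fun a ⟨b, hb, h⟩ => ⟨b, hb.2, h⟩
    · rw [sSup_inf_sSup]
      refine iSup₂_le ?_
      rintro ⟨a, a'⟩ ⟨⟨b, hb, h⟩, b', hb', h'⟩
      exact le_sSup ⟨b ⊔ b', ⟨S.upper le_sup_left hb, T.upper le_sup_right hb'⟩,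
        rect_sup_right_le ((rect_mono inf_le_left le_rfl).trans h)
          ((rect_mono inf_le_right le_rfl).trans h')⟩
  map_top' := top_le_iff.1 (le_sSup ⟨⊥, trivial, rect_bot_le _ _⟩)
  map_sSup' s := by
    refine le_antisymm (sSup_le ?_) (sSup_le ?_)
    · rintro a ⟨b, hb, h⟩
      obtain ⟨S, hS, hbS⟩ := TopologicalSpace.Opens.mem_sSup.1 hb
      exact (le_sSup (show a ∈ {a | ∃ b ∈ S, rect a b ≤ W} from ⟨b, hbS, h⟩)).trans
        (le_sSup ⟨S, hS, rfl⟩)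
    · rintro _ ⟨S, hS, rfl⟩
      exact sSup_le_sSup fun a ⟨b, hb, h⟩ =>
        ⟨b, TopologicalSpace.Opens.mem_sSup.2 ⟨S, hS, hb⟩, h⟩

/-- The morphism `A ⟶ 𝕊^X` classifying `W`. -/
def powerHom (W : (A ⊗ X : Locale.{u})) : A ⟶ powerLocale X := ofFrameHom (powerDesc W)

theorem inverseImage_whiskerRight_rect_power (f : A ⟶ powerLocale X) (S : ScottOpens X) (b : X) :
    inverseImage (f ▷ X) (rect (A := powerLocale X) S b) = rect (inverseImage f S) b :=
  inverseImage_whiskerRight_rect f S b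

theorem inverseImage_sSup_power (f : A ⟶ powerLocale X) (s : Set (ScottOpens X)) :
    inverseImage f (sSup s : ScottOpens X) =
      sSup ((fun S : ScottOpens X => inverseImage f S) '' s) :=
  (inverseImage f).map_sSup' s

theorem le_powerDesc (W : (A ⊗ X : Locale.{u})) {S : ScottOpens X} {a : A} {b : X} (hb : b ∈ S)
    (h : rect a b ≤ W) : a ≤ powerDesc W S :=
  le_sSup ⟨b, hb, h⟩

theorem powerDesc_le (W : (A ⊗ X : Locale.{u})) {S : ScottOpens X} {c : A}
    (h : ∀ a, ∀ b ∈ S, rect a b ≤ W → a ≤ c) : powerDesc W S ≤ c :=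
  sSup_le fun a ⟨b, hb, hab⟩ => h a b hb hab

/-- Existence of transposes. Regularity is needed for `W ≤ …`: if `b'` is well inside `b`, the basic
Scott open set of `b'` contains `b`, and its rectangle with `b'` lies in `evOpen X`. -/
theorem IsCompactHausdorff.inverseImage_powerDesc_evOpen (hX : IsCompactHausdorff X)
    (W : (A ⊗ X : Locale.{u})) :
    inverseImage (powerHom W ▷ X) (evOpen X) = W := by
  refine le_antisymm ?_ ((open_le_iff _ _).2 fun a b hab => ?_)
  · rw [inverseImage_le_iff]
    intro (S : ScottOpens X) b hS
    rw [rect_le_evOpen] at hS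
    refine (inverseImage_whiskerRight_rect_power (powerHom W) S b).le.trans ?_
    refine rect_sSup_left_le ?_
    rintro a ⟨c, hc, h⟩
    exact (rect_mono le_rfl (hS c hc)).trans h
  · rw [← hX.sSup_wellInside b]
    refine rect_sSup_right_le fun b' hb' => ?_
    refine le_trans (rect_mono (le_powerDesc W (S := wellInsideOpens hX.compact b') hb' hab) le_rfl) ?_
    refine (inverseImage_whiskerRight_rect_power (powerHom W) _ b').ge.trans ?_
    exact OrderHomClass.mono _ ((rect_le_evOpen _ _).2 fun c hc => le_of_mem_wellInsideOpens hc)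

/-- Uniqueness of transposes: `f` is recovered from the open it classifies. -/
theorem IsCompactHausdorff.powerDesc_inverseImage_evOpen (hX : IsCompactHausdorff X)
    (f : A ⟶ powerLocale X) (S : ScottOpens X) :
    powerDesc (inverseImage (f ▷ X) (evOpen X)) S = inverseImage f S := by
  classical
  refine le_antisymm (powerDesc_le _ fun a b hb hab => ?_) ?_
  -- `V` bounds the pulled back evaluation open: a rectangle `a × b` in it forces `a` below `f^* S`
  -- for every Scott open set `S` containing `b`.
  · obtain ⟨V, hV⟩ := exists_open_of_closed (A := A) (B := X)
      (fun a b => ∀ S : ScottOpens X, b ∈ S → a ≤ inverseImage f S)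
      (fun ha hb h S hS => ha.trans (h S (S.upper hb hS)))
      (fun s b h S hS => sSup_le fun a ha => h a ha S hS)
      (by
        intro a t h S hS
        obtain ⟨F, hF, hFS⟩ := S.exists_finset hS
        clear hS
        induction F using Finset.induction_on generalizing S with
        | empty =>
          have : S = ⊤ := by
            exact top_le_iff.1 fun c _ => S.upper (by simp) hFS
          rw [this]
          exact le_top.trans (map_top (inverseImage f)).ge
        | insert b F _ ih =>
          rw [Finset.sup_insert, id] at hFS
          -- The Scott open set `S` shifted by `F.sup id` contains `b` and is a join of basic sets
          -- indexed by `c` with `F.sup id ⊔ c ∈ S`. Induction applies to `S` shifted by `c`, and an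
          -- `x` in both that set and the basic set of `c` satisfies `c ≤ x`, so `c ⊔ x = x` lies in
          -- `S`.
          have h₁ := h b (hF (by simp)) (S.supPreimage (F.sup id))
            (by rw [sup_comm] at hFS; exact hFS)
          rw [hX.eq_sSup_wellInsideOpens (S.supPreimage (F.sup id))] at h₁
          replace h₁ := h₁.trans (inverseImage_sSup_power f _).le
          rw [← inf_eq_left.2 h₁, inf_sSup_eq]
          refine iSup₂_le ?_
          rintro _ ⟨_, ⟨c, hc, rfl⟩, rfl⟩
          have h₂ := ih (S.supPreimage c) (fun x hx => hF (Finset.mem_insert_of_mem hx))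
            (show c ⊔ F.sup id ∈ S by rw [sup_comm]; exact hc)
          refine (inf_le_inf_right _ h₂).trans ((map_inf (inverseImage f) _ _).ge.trans ?_)
          refine OrderHomClass.mono (inverseImage f) ?_
          rintro x ⟨hx₁, hx₂⟩
          have hx₁ : c ⊔ x ∈ S := hx₁
          rwa [sup_eq_right.2 (le_of_mem_wellInsideOpens hx₂)] at hx₁)
    refine (hV a b).1 (hab.trans ?_) S hb
    rw [inverseImage_le_iff]
    intro (T : ScottOpens X) b hT
    rw [rect_le_evOpen] at hT
    refine (inverseImage_whiskerRight_rect_power f T b).le.trans ((hV _ _).2 ?_)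
    exact fun S hS => OrderHomClass.mono (inverseImage f) fun c hc => S.upper (hT c hc) hS
  · conv_lhs => rw [hX.eq_sSup_wellInsideOpens S]
    refine (inverseImage_sSup_power f _).le.trans (sSup_le ?_)
    rintro _ ⟨_, ⟨b, hb, rfl⟩, rfl⟩
    refine le_powerDesc _ hb ?_
    refine (inverseImage_whiskerRight_rect_power f _ b).ge.trans ?_
    exact OrderHomClass.mono _ ((rect_le_evOpen _ _).2 fun c hc => le_of_mem_wellInsideOpens hc)

theorem opensEquiv_comp {A B : Locale.{u}} (f : A ⟶ B) (g : B ⟶ sierpinski) :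
    opensEquiv A (f ≫ g) = inverseImage f (opensEquiv B g) := rfl

theorem IsCompactHausdorff.nonempty_sierpinskiPower (hX : IsCompactHausdorff X) :
    Nonempty (SierpinskiPower X) := by
  refine ⟨⟨powerLocale X, (opensEquiv _).symm (evOpen X), fun A f =>
    ⟨powerHom (opensEquiv _ f), ?_, fun g hg => ?_⟩⟩⟩
  · refine (opensEquiv _).injective ?_
    change opensEquiv _ (_ ≫ _) = _
    rw [opensEquiv_comp, Equiv.apply_symm_apply]
    exact hX.inverseImage_powerDesc_evOpen _
  · refine locale_hom_ext fun S => ?_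
    rw [← hg, opensEquiv_comp, Equiv.apply_symm_apply]
    exact (hX.powerDesc_inverseImage_evOpen g S).symm

end Exponential

/-! ## Opens classified by morphisms to an exponential -/

theorem whiskerRight_le_whiskerRight {A B : Locale.{u}} {f g : A ⟶ B} (h : f ≤ g)
    (C : Locale.{u}) : f ▷ C ≤ g ▷ C := by
  rw [hom_le_iff]
  simp only [whiskerRight_fst, whiskerRight_snd]
  exact ⟨comp_le_comp le_rfl h, le_rfl⟩

theorem opensEquiv_symm_le {A : Locale.{u}} {a b : A} (h : a ≤ b) :
    (opensEquiv A).symm a ≤ (opensEquiv A).symm b := fun _ =>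
  sup_le_sup_left (iSup_mono fun _ => h) _

theorem inverseImage_opensEquiv_symm {A : Locale.{u}} (a : A) :
    inverseImage ((opensEquiv A).symm a) genericOpen = a :=
  (opensEquiv A).apply_symm_apply a

namespace SierpinskiPower

variable {X Y A B : Locale.{u}}

theorem classified_comp (E : SierpinskiPower X) (f : A ⟶ B) (g : B ⟶ E.obj) :
    E.classified (f ≫ g) = inverseImage (f ▷ X) (E.classified g) := by
  rw [classified, untranspose, comp_whiskerRight, Category.assoc]
  rfl

theorem untranspose_transpose (E : SierpinskiPower X) (f : A ⊗ X ⟶ sierpinski) :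
    E.untranspose (E.transpose f) = f :=
  (E.existsUnique_transpose A f).choose_spec.1

theorem transpose_untranspose (E : SierpinskiPower X) (g : A ⟶ E.obj) :
    E.transpose (E.untranspose g) = g :=
  ((E.existsUnique_transpose A (E.untranspose g)).choose_spec.2 g rfl).symm

theorem classified_transpose (E : SierpinskiPower X) (f : A ⊗ X ⟶ sierpinski) :
    E.classified (E.transpose f) = opensEquiv _ f := by
  rw [classified, untranspose_transpose]

theorem classified_injective (E : SierpinskiPower X) {g h : A ⟶ E.obj}
    (hgh : E.classified g = E.classified h) : g = h := by
  rw [← E.transpose_untranspose g, (opensEquiv _).injective hgh, E.transpose_untranspose]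

/-- The universal property of `E` mentions only equality of morphisms. The order is recovered by
joining `g` to `h` through one morphism `H` on `A × 𝕊`, whose restrictions at `⊥ ≤ ⊤` are `g` and
`h`. -/
theorem le_of_classified_le (E : SierpinskiPower X) {g h : A ⟶ E.obj}
    (hgh : E.classified g ≤ E.classified h) : g ≤ h := by
  let W : ((A ⊗ sierpinski) ⊗ X : Locale.{u}) :=
    inverseImage (fst A sierpinski ▷ X) (E.classified g) ⊔
      (inverseImage (fst A sierpinski ▷ X) (E.classified h) ⊓
        inverseImage (fst _ X) (inverseImage (snd A sierpinski) genericOpen))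
  let H : A ⊗ sierpinski ⟶ E.obj := E.transpose ((opensEquiv _).symm W)
  let s (a : A) : A ⟶ A ⊗ sierpinski := lift (𝟙 A) ((opensEquiv A).symm a)
  have key : ∀ a : A, E.classified (s a ≫ H) =
      E.classified g ⊔ (E.classified h ⊓ inverseImage (fst A X) a) := by
    intro a
    rw [classified_comp, classified_transpose, Equiv.apply_symm_apply]
    have h₁ : ∀ V : (A ⊗ X : Locale.{u}),
        inverseImage (s a ▷ X) (inverseImage (fst A sierpinski ▷ X) V) = V := by
      intro V
      rw [← inverseImage_comp, ← comp_whiskerRight, lift_fst, id_whiskerRight]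
      rfl
    have h₂ : inverseImage (s a ▷ X)
        (inverseImage (fst _ X) (inverseImage (snd A sierpinski) genericOpen)) =
        inverseImage (fst A X) a := by
      rw [← inverseImage_comp, whiskerRight_fst, inverseImage_comp, ← inverseImage_comp (s a),
        lift_snd, inverseImage_opensEquiv_symm]
    simp only [W]
    rw [map_sup, map_inf, h₁, h₁, h₂]
  have hg : s ⊥ ≫ H = g := E.classified_injective (by rw [key, map_bot, inf_bot_eq, sup_bot_eq])
  have hh : s ⊤ ≫ H = h := E.classified_injective (by
    rw [key, map_top, inf_top_eq, sup_eq_right.2 hgh])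
  rw [← hg, ← hh]
  refine comp_le_comp ((hom_le_iff _ _).2 ⟨?_, ?_⟩) le_rfl
  · simp only [s, lift_fst]
    exact le_rfl
  · simp only [s, lift_snd]
    exact opensEquiv_symm_le bot_le

theorem le_iff_classified_le (E : SierpinskiPower X) {g h : A ⟶ E.obj} :
    g ≤ h ↔ E.classified g ≤ E.classified h :=
  ⟨fun hgh => whiskerRight_le_whiskerRight hgh X _, E.le_of_classified_le⟩

theorem classified_comp_map (E : SierpinskiPower X) (F : SierpinskiPower Y) (φ : Y ⟶ X)
    (h : A ⟶ E.obj) :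
    F.classified (h ≫ E.map F φ) = inverseImage (A ◁ φ) (E.classified h) := by
  rw [classified_comp, map, classified_transpose, opensEquiv_comp, ← inverseImage_comp,
    ← whisker_exchange, inverseImage_comp]
  rfl

theorem classified_join (E : SierpinskiPower X) (g h : A ⟶ E.obj) :
    E.classified (E.join g h) = E.classified g ⊔ E.classified h := by
  rw [join, classified_transpose, opensEquiv_comp, sierpinskiJoin, Equiv.apply_symm_apply,
    map_sup, ← inverseImage_comp, ← inverseImage_comp, lift_fst, lift_snd]
  rfl

theorem classified_bot (E : SierpinskiPower X) : E.classified E.bot = ⊥ := by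
  rw [bot, classified_transpose, opensEquiv_comp, sierpinskiBot, Equiv.apply_symm_apply, map_bot]

theorem classified_singletonMap (E : SierpinskiPower X) :
    E.classified (singletonMap E) = diagonalCompl X := by
  rw [singletonMap, classified_transpose, diagonalMap, Equiv.apply_symm_apply]

theorem classified_comp_diagonalPoint (F : SierpinskiPower (X ⊗ X)) (A : Locale.{u}) :
    F.classified (toUnit A ≫ diagonalPoint F) = inverseImage (snd A (X ⊗ X)) (diagonalCompl X) := by
  rw [classified_comp, diagonalPoint, classified_transpose, opensEquiv_comp, diagonalMap,
    Equiv.apply_symm_apply, ← inverseImage_comp]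
  congr 2
  rw [leftUnitor_hom, whiskerRight_snd]

end SierpinskiPower

/-! ## Images of closed sublocales along `A × X ⟶ A × 1` -/

section Image

variable {A B X : Locale.{u}}

/-- Since `A × 1 ≅ A`, the image along `A × !` is the image along the first projection. -/
theorem directImage_whiskerLeft_toUnit (W : (A ⊗ X : Locale.{u})) :
    directImage (A ◁ toUnit X) W =
      inverseImage (fst A (𝟙_ Locale.{u})) (directImage (fst A X) W) := by
  refine eq_of_forall_le_iff fun v => ?_
  have hv : v = inverseImage (fst A (𝟙_ Locale.{u})) (inverseImage (ρ_ A).inv v) := by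
    rw [← inverseImage_comp, ← rightUnitor_hom, Iso.hom_inv_id]
    rfl
  have hle : ∀ a b : A, inverseImage (fst A (𝟙_ Locale.{u})) a ≤
      inverseImage (fst A (𝟙_ Locale.{u})) b ↔ a ≤ b := by
    refine fun a b => ⟨fun h => ?_, fun h => OrderHomClass.mono _ h⟩
    have h' := OrderHomClass.mono (inverseImage (ρ_ A).inv) h
    rw [← inverseImage_comp, ← inverseImage_comp, ← rightUnitor_hom, Iso.inv_hom_id] at h'
    exact h'
  rw [le_directImage_iff, hv, hle, le_directImage_iff, ← inverseImage_comp, whiskerLeft_fst]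

theorem directImage_mono {f : A ⟶ B} {a b : A} (h : a ≤ b) : directImage f a ≤ directImage f b :=
  (le_directImage_iff _ _ _).2 (((le_directImage_iff _ _ _).1 le_rfl).trans h)

/-- The right adjoint `𝕊^X ⟶ 𝕊^1` of `𝕊^!`. -/
noncomputable def imageMap (E : SierpinskiPower X) (G : SierpinskiPower (𝟙_ Locale.{u})) :
    E.obj ⟶ G.obj :=
  G.transpose ((opensEquiv _).symm (directImage (E.obj ◁ toUnit X) (opensEquiv _ E.ev)))

/-- `imageMap` is defined by the image of the generic open only; Beck–Chevalley transports this to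
every `h`. -/
theorem classified_comp_imageMap (hX : IsCompactLocale X) (E : SierpinskiPower X)
    (G : SierpinskiPower (𝟙_ Locale.{u})) (h : A ⟶ E.obj) :
    G.classified (h ≫ imageMap E G) = directImage (A ◁ toUnit X) (E.classified h) := by
  have hev : E.classified h = inverseImage (h ▷ X) (opensEquiv _ E.ev) := rfl
  rw [G.classified_comp, imageMap, G.classified_transpose, Equiv.apply_symm_apply,
    directImage_whiskerLeft_toUnit, directImage_whiskerLeft_toUnit, hev,
    hX.directImage_fst_whiskerRight, ← inverseImage_comp, ← inverseImage_comp, whiskerRight_fst]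

/-- The unit and counit are those of `p^* ⊣ p_*`, read on the opens classified by identity
morphisms. -/
theorem isRightAdjointOf_imageMap (hX : IsCompactLocale X) (E : SierpinskiPower X)
    (G : SierpinskiPower (𝟙_ Locale.{u})) :
    IsRightAdjointOf (imageMap E G) (G.map E (toUnit X)) := by
  constructor
  · rw [G.le_iff_classified_le, classified_comp_imageMap hX, le_directImage_iff]
    have h := G.classified_comp_map E (toUnit X) (𝟙 _)
    rw [Category.id_comp] at h
    exact h.ge
  · rw [E.le_iff_classified_le, G.classified_comp_map, ← le_directImage_iff]
    have h := classified_comp_imageMap hX E G (𝟙 _)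
    rw [Category.id_comp] at h
    exact h.le

end Image

/-! ## The inserter -/

section Inserter

variable {A X : Locale.{u}}

/-- The conditions on a closed sublocale of `A × X`, given by its open complement `W`, that make
it the graph of a morphism `A ⟶ X`. -/
structure IsGraphCompl (W : (A ⊗ X : Locale.{u})) : Prop where
  subsingleton : inverseImage (snd A (X ⊗ X)) (diagonalCompl X) ≤
    inverseImage (A ◁ fst X X) W ⊔ inverseImage (A ◁ snd X X) W
  total : directImage (fst A X) W ≤ ⊥

theorem inserter_condition_iff (hX : IsCompactLocale X) (E : SierpinskiPower X)
    (F : SierpinskiPower (X ⊗ X)) (G : SierpinskiPower (𝟙_ Locale.{u})) (h : A ⟶ E.obj) :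
    h ≫ lift (toUnit E.obj ≫ diagonalPoint F) (imageMap E G) ≤
      h ≫ lift (F.join (E.map F (fst X X)) (E.map F (snd X X))) (toUnit E.obj ≫ G.bot) ↔
    IsGraphCompl (E.classified h) := by
  have h₁ : h ≫ toUnit E.obj = toUnit A := toUnit_unique _ _
  rw [hom_le_iff]
  simp only [Category.assoc, lift_fst, lift_snd]
  rw [F.le_iff_classified_le, G.le_iff_classified_le, ← Category.assoc, h₁,
    F.classified_comp_diagonalPoint, F.classified_comp, F.classified_join, map_sup,
    ← F.classified_comp, ← F.classified_comp, E.classified_comp_map, E.classified_comp_map,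
    classified_comp_imageMap hX, ← Category.assoc, h₁, G.classified_comp, G.classified_bot,
    map_bot, directImage_whiskerLeft_toUnit]
  have h₂ : inverseImage (fst A (𝟙_ Locale.{u})) (directImage (fst A X) (E.classified h)) ≤ ⊥ ↔
      directImage (fst A X) (E.classified h) ≤ ⊥ := by
    refine ⟨fun h => ?_, fun h => (OrderHomClass.mono _ h).trans (map_bot _).le⟩
    have h' := OrderHomClass.mono (inverseImage (ρ_ A).inv) h
    rw [← inverseImage_comp, ← rightUnitor_hom, Iso.inv_hom_id, map_bot] at h'
    exact h'
  rw [h₂]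
  exact ⟨fun h => ⟨h.1, h.2⟩, fun h => ⟨h.1, h.2⟩⟩

theorem inf_le_sup_of_inf_eq_bot {L : Type*} [DistribLattice L] [OrderBot L] {b c x y p q : L}
    (hbc : b ⊓ c = ⊥) (hx : x ≤ b ⊔ p) (hy : y ≤ c ⊔ q) : x ⊓ y ≤ p ⊔ q :=
  calc x ⊓ y ≤ (b ⊔ (p ⊔ q)) ⊓ (c ⊔ (p ⊔ q)) :=
        inf_le_inf (hx.trans (sup_le_sup_left le_sup_left b))
          (hy.trans (sup_le_sup_left le_sup_right c))
    _ = p ⊔ q := by rw [← sup_inf_right, hbc, bot_sup_eq]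

theorem IsHausdorffLocale.isGraphCompl_diagonalCompl (hX : IsHausdorffLocale X) :
    IsGraphCompl (diagonalCompl X) := by
  constructor
  · rw [inverseImage_le_iff]
    intro b c hbc
    rw [rect_le_diagonalCompl] at hbc
    -- With coordinates `(w, x, y)` on `X × (X × X)`: from `x ∈ b` either `w ∈ b` or `w ≠ x`, and
    -- from `y ∈ c` either `w ∈ c` or `w ≠ y`. As `b` and `c` are disjoint, `w` differs from `x` or
    -- from `y`.
    have h₁ := OrderHomClass.mono (inverseImage (X ◁ fst X X)) (hX.snd_le b)
    have h₂ := OrderHomClass.mono (inverseImage (X ◁ snd X X)) (hX.snd_le c)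
    rw [map_sup, ← inverseImage_comp, ← inverseImage_comp, whiskerLeft_fst, whiskerLeft_snd]
      at h₁ h₂
    rw [inverseImage_rect]
    exact inf_le_sup_of_inf_eq_bot (by rw [← map_inf, hbc, map_bot]) h₁ h₂
  · have h := (le_directImage_iff (fst X X) (diagonalCompl X) _).1 le_rfl
    have h' := OrderHomClass.mono (inverseImage (diagonal X)) h
    rwa [inverseImage_diagonal_fst, inverseImage_diagonal_diagonalCompl] at h'

/-- Pushing forward a join of opens in independent variables along `A × (X × Y) ⟶ A`. -/
theorem le_directImage_sup_directImage {Y : Locale.{u}} (hX : IsCompactLocale X)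
    (hY : IsCompactLocale Y) {U : (A ⊗ X : Locale.{u})} {V : (A ⊗ Y : Locale.{u})} {a : A}
    (h : inverseImage (fst A (X ⊗ Y)) a ≤
      inverseImage (A ◁ fst X Y) U ⊔ inverseImage (A ◁ snd X Y) V) :
    a ≤ directImage (fst A X) U ⊔ directImage (fst A Y) V := by
  rw [← rect_top] at h
  -- Over each generating `a`, `w` lies in a union of two strips `x × Y` and `X × y`. If `w = ⊤`,
  -- one of `x`, `y` is `⊤`, so `a` lies in the corresponding image.
  refine ((hX.prod hY).le_sSup_of_rect_top_le (fun a w => ∃ x y, rect a x ≤ U ∧ rect a y ≤ V ∧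
    w ≤ inverseImage (fst X Y) x ⊔ inverseImage (snd X Y) y) ?_ ?_ ?_ h).trans (sSup_le ?_)
  · exact fun a => ⟨⊥, ⊥, rect_bot_le _ _, rect_bot_le _ _, bot_le⟩
  · rintro a a' w w' ⟨x, y, h₁, h₂, h₃⟩ ⟨x', y', h₁', h₂', h₃'⟩
    refine ⟨x ⊔ x', y ⊔ y', rect_sup_right_le ((rect_mono inf_le_left le_rfl).trans h₁)
      ((rect_mono inf_le_right le_rfl).trans h₁'),
      rect_sup_right_le ((rect_mono inf_le_left le_rfl).trans h₂)
      ((rect_mono inf_le_right le_rfl).trans h₂'), ?_⟩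
    rw [map_sup, map_sup, sup_sup_sup_comm]
    exact sup_le_sup h₃ h₃'
  · intro T hT
    refine sup_le ?_ ?_ <;>
    · rw [inverseImage_le_iff]
      intro b x hbx
      rw [inverseImage_whiskerLeft_rect]
      first
      | exact hT _ _ ⟨x, ⊥, hbx, rect_bot_le _ _, le_sup_left⟩
      | exact hT _ _ ⟨⊥, x, rect_bot_le _ _, hbx, le_sup_right⟩
  · rintro b ⟨x, y, h₁, h₂, h₃⟩
    rcases eq_top_or_eq_top_of_sup_eq_top (top_le_iff.1 h₃) with rfl | rfl
    · exact le_sup_of_le_left (rect_top_le_iff.1 h₁)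
    · exact le_sup_of_le_right (rect_top_le_iff.1 h₂)

/-- The two alternatives are put in independent copies of `X`: the condition `y` on the first copy
implies `y` on the second unless the copies differ, and then one of them lies in `W` by
`hW.subsingleton`. `le_directImage_sup_directImage` separates the copies. -/
theorem IsCompactHausdorff.directImage_sup_le (hX : IsCompactHausdorff X)
    {W : (A ⊗ X : Locale.{u})} (hW : IsGraphCompl W) (x y : X) :
    directImage (fst A X) (W ⊔ inverseImage (snd A X) (x ⊔ y)) ≤
      directImage (fst A X) (W ⊔ inverseImage (snd A X) x) ⊔
        directImage (fst A X) (W ⊔ inverseImage (snd A X) y) := by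
  refine le_directImage_sup_directImage hX.compact hX.compact ?_
  have h₁ := OrderHomClass.mono (inverseImage (A ◁ fst X X))
    ((le_directImage_iff (fst A X) (W ⊔ inverseImage (snd A X) (x ⊔ y)) _).1 le_rfl)
  have h₂ := OrderHomClass.mono (inverseImage (snd A (X ⊗ X))) (hX.hausdorff.fst_le y)
  have h₃ : ∀ z : X, inverseImage (A ◁ fst X X) (inverseImage (snd A X) z) =
      inverseImage (snd A (X ⊗ X)) (inverseImage (fst X X) z) := fun z => by
    rw [← inverseImage_comp, whiskerLeft_snd, inverseImage_comp]
  have h₄ : ∀ z : X, inverseImage (A ◁ snd X X) (inverseImage (snd A X) z) =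
      inverseImage (snd A (X ⊗ X)) (inverseImage (snd X X) z) := fun z => by
    rw [← inverseImage_comp, whiskerLeft_snd, inverseImage_comp]
  rw [← inverseImage_comp, whiskerLeft_fst, map_sup, map_sup, map_sup, h₃, h₃] at h₁
  rw [map_sup] at h₂
  rw [map_sup (inverseImage (A ◁ fst X X)), map_sup (inverseImage (A ◁ snd X X)), h₃, h₄]
  rw [map_sup (inverseImage (snd A X))]
  refine h₁.trans (sup_le (le_sup_of_le_left le_sup_left) (sup_le
    (le_sup_of_le_left le_sup_right) (h₂.trans (sup_le (le_sup_of_le_right le_sup_right)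
      (hW.subsingleton.trans (sup_le_sup le_sup_left le_sup_left))))))

/-- The inverse image map of the morphism `A ⟶ X` whose graph is the complement of `W`. -/
def graphDesc (hX : IsCompactHausdorff X) {W : (A ⊗ X : Locale.{u})} (hW : IsGraphCompl W) :
    FrameHom X A where
  toFun x := directImage (fst A X) (W ⊔ inverseImage (snd A X) x)
  map_inf' x y := by
    refine eq_of_forall_le_iff fun a => ?_
    rw [le_inf_iff, le_directImage_iff, le_directImage_iff, le_directImage_iff, map_inf,
      sup_inf_left, le_inf_iff]
  map_top' := by
    rw [eq_top_iff, le_directImage_iff, map_top, map_top, sup_top_eq]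
  map_sSup' s := by
    classical
    have mono : ∀ {x y : X}, x ≤ y → directImage (fst A X) (W ⊔ inverseImage (snd A X) x) ≤
        directImage (fst A X) (W ⊔ inverseImage (snd A X) y) := fun h =>
      directImage_mono (sup_le_sup_left (OrderHomClass.mono _ h) W)
    refine le_antisymm ?_ (sSup_le ?_)
    -- An arbitrary join is a directed join of finite ones: compactness handles the former, while
    -- totality and `directImage_sup_le` handle the latter.
    · let f (F : Finset X) : (A ⊗ X : Locale.{u}) := W ⊔ inverseImage (snd A X) (F.sup id)
      have hf : Monotone f := fun F G h =>
        sup_le_sup_left (OrderHomClass.mono _ (Finset.sup_mono h)) W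
      have h₁ : W ⊔ inverseImage (snd A X) (sSup s) ≤ sSup (f '' {F | ↑F ⊆ s}) := by
        refine sup_le ?_ ?_
        · exact le_sup_left.trans (le_sSup ⟨∅, by simp, rfl⟩)
        · rw [map_sSup]
          refine sSup_le ?_
          rintro _ ⟨x, hx, rfl⟩
          refine le_trans ?_ (le_sSup ⟨{x}, by simpa using hx, rfl⟩)
          simp only [f, Finset.sup_singleton, id]
          exact le_sup_right
      refine (directImage_mono h₁).trans ?_
      rw [hX.compact.directImage_fst_sSup (Set.Nonempty.image f ⟨∅, by simp⟩)]
      · refine sSup_le ?_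
        rintro _ ⟨_, ⟨F, hF, rfl⟩, rfl⟩
        have key : ∀ F : Finset X, (∀ x ∈ F, x ∈ s) → directImage (fst A X) (f F) ≤
            sSup ((fun x => directImage (fst A X) (W ⊔ inverseImage (snd A X) x)) '' s) := by
          intro F
          induction F using Finset.induction_on with
          | empty =>
            intro _
            simp only [f]
            rw [Finset.sup_empty, map_bot, sup_bot_eq]
            exact hW.total.trans bot_le
          | insert x F _ ih =>
            intro hF
            simp only [f]
            rw [Finset.sup_insert]
            exact (hX.directImage_sup_le hW _ _).trans (sup_le
              (le_sSup ⟨x, hF x (by simp), rfl⟩)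
              (ih fun y hy => hF y (Finset.mem_insert_of_mem hy)))
        exact key F fun x hx => hF hx
      · rintro _ ⟨F, hF, rfl⟩ _ ⟨G, hG, rfl⟩
        refine ⟨_, ⟨F ∪ G, ?_, rfl⟩, hf Finset.subset_union_left, hf Finset.subset_union_right⟩
        simpa using ⟨hF, hG⟩
    · rintro _ ⟨x, hx, rfl⟩
      exact mono (le_sSup hx)

/-- The morphism `A ⟶ X` whose graph is the complement of `W`. -/
def graphHom (hX : IsCompactHausdorff X) {W : (A ⊗ X : Locale.{u})} (hW : IsGraphCompl W) :
    A ⟶ X := ofFrameHom (graphDesc hX hW)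

theorem le_inverseImage_graphHom_iff (hX : IsCompactHausdorff X) {W : (A ⊗ X : Locale.{u})}
    (hW : IsGraphCompl W) (a : A) (x : X) : a ≤ inverseImage (graphHom hX hW) x ↔
      inverseImage (fst A X) a ≤ W ⊔ inverseImage (snd A X) x :=
  le_directImage_iff (fst A X) _ a

/-- The complement of the graph is `W`. Disjointness of `b` and `c` gives one inclusion. For the
other, if `a × c ≤ W` and `c'` is well inside `c` with witness `z`, then over `a` the fibre avoids
`c`, hence lies in `z`, which is disjoint from `c'`. -/
theorem inverseImage_graphHom_diagonalCompl (hX : IsCompactHausdorff X)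
    {W : (A ⊗ X : Locale.{u})} (hW : IsGraphCompl W) :
    inverseImage (graphHom hX hW ▷ X) (diagonalCompl X) = W := by
  refine le_antisymm ?_ ((open_le_iff _ _).2 fun a c hac => ?_)
  · rw [inverseImage_le_iff]
    intro b c hbc
    rw [rect_le_diagonalCompl] at hbc
    rw [inverseImage_whiskerRight_rect]
    have h := (le_inverseImage_graphHom_iff hX hW _ b).1 le_rfl
    refine (inf_le_inf_right _ h).trans ?_
    rw [inf_sup_right, ← map_inf, hbc, map_bot, sup_bot_eq]
    exact inf_le_left
  · refine (rect_mono le_rfl (hX.le_sSup_wellInside c)).trans (rect_sSup_right_le ?_)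
    rintro c' ⟨z, h₁, h₂⟩
    have h : a ≤ inverseImage (graphHom hX hW) z := by
      rw [le_inverseImage_graphHom_iff, ← rect_top, ← h₂]
      exact rect_sup_right_le (inf_le_right.trans le_sup_right) (hac.trans le_sup_left)
    refine (rect_mono h le_rfl).trans ?_
    rw [← inverseImage_whiskerRight_rect]
    exact OrderHomClass.mono _ (rect_le_diagonalCompl.2 (by rw [inf_comm, h₁]))

theorem IsCompactHausdorff.le_of_inverseImage_diagonalCompl_le (hX : IsCompactHausdorff X)
    {k k' : A ⟶ X} (h : inverseImage (k ▷ X) (diagonalCompl X) ≤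
      inverseImage (k' ▷ X) (diagonalCompl X)) : k ≤ k' := by
  intro v
  refine (OrderHomClass.mono (inverseImage k) (hX.le_sSup_wellInside v)).trans ?_
  rw [map_sSup]
  refine sSup_le ?_
  rintro _ ⟨v', ⟨z, h₁, h₂⟩, rfl⟩
  have h₃ : rect (inverseImage k v') z ≤ inverseImage (k' ▷ X) (diagonalCompl X) := by
    rw [← inverseImage_whiskerRight_rect]
    exact (OrderHomClass.mono _ (rect_le_diagonalCompl.2 h₁)).trans h
  -- Restriction to the graph of `k'`, where the complement of that graph becomes `⊥`: hence `k^*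
  -- v'` is disjoint from `k'^* z`, and `z ⊔ v = ⊤` places it inside `k'^* v`.
  have h₄ := OrderHomClass.mono (inverseImage (lift (𝟙 A) k')) h₃
  have h₅ : lift (𝟙 A) k' ≫ k' ▷ X = k' ≫ diagonal X := by simp [diagonal]
  rw [← inverseImage_comp, h₅, inverseImage_comp, inverseImage_diagonal_diagonalCompl, map_bot,
    inverseImage_rect, lift_fst, lift_snd] at h₄
  have h₆ : inverseImage k v' ⊓ inverseImage k' z ≤ ⊥ := h₄
  calc inverseImage k v' = inverseImage k v' ⊓ inverseImage k' (z ⊔ v) := by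
        rw [h₂, map_top, inf_top_eq]
    _ = (inverseImage k v' ⊓ inverseImage k' z) ⊔ (inverseImage k v' ⊓ inverseImage k' v) := by
        rw [map_sup, inf_sup_left]
    _ ≤ inverseImage k' v := sup_le (h₆.trans bot_le) inf_le_right

theorem isInserter_singletonMap (hX : IsCompactHausdorff X) (E : SierpinskiPower X)
    (F : SierpinskiPower (X ⊗ X)) (G : SierpinskiPower (𝟙_ Locale.{u})) :
    IsInserter (singletonMap E) (lift (toUnit E.obj ≫ diagonalPoint F) (imageMap E G))
      (lift (F.join (E.map F (fst X X)) (E.map F (snd X X))) (toUnit E.obj ≫ G.bot)) where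
  condition := by
    rw [inserter_condition_iff hX.compact, E.classified_singletonMap]
    exact hX.hausdorff.isGraphCompl_diagonalCompl
  existsUnique_lift A h hh := by
    rw [inserter_condition_iff hX.compact] at hh
    have hlift : graphHom hX hh ≫ singletonMap E = h := E.classified_injective (by
      rw [E.classified_comp, E.classified_singletonMap, inverseImage_graphHom_diagonalCompl])
    refine ⟨graphHom hX hh, hlift, fun k hk => ?_⟩
    have hk' := congrArg E.classified (hk.trans hlift.symm)
    rw [E.classified_comp, E.classified_comp, E.classified_singletonMap] at hk'
    exact le_antisymm (hX.le_of_inverseImage_diagonalCompl_le hk'.le)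
      (hX.le_of_inverseImage_diagonalCompl_le hk'.ge)
  le_of_comp_le A k k' h := by
    rw [E.le_iff_classified_le, E.classified_comp, E.classified_comp,
      E.classified_singletonMap] at h
    exact hX.le_of_inverseImage_diagonalCompl_le h

end Inserter

end CompactHausdorffLocale

open CompactHausdorffLocale in
theorem mainTheorem8 (X : Locale.{u}) (hX : IsCompactHausdorff X) :
    (IsCompactHausdorff (X ⊗ X) ∧ IsCompactHausdorff (𝟙_ Locale.{u})) ∧
    (Nonempty (SierpinskiPower X) ∧ Nonempty (SierpinskiPower (X ⊗ X)) ∧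
      Nonempty (SierpinskiPower (𝟙_ Locale.{u}))) ∧
    ∀ (E : SierpinskiPower X) (F : SierpinskiPower (X ⊗ X)) (G : SierpinskiPower (𝟙_ Locale.{u})),
      ∃ r : E.obj ⟶ G.obj,
        IsRightAdjointOf r (G.map E (toUnit X)) ∧
        (∀ (A : Locale.{u}) (h : A ⟶ E.obj),
          G.classified (h ≫ r) = directImage (A ◁ toUnit X) (E.classified h)) ∧
        IsInserter (singletonMap E)
          (lift (toUnit E.obj ≫ diagonalPoint F) r)
          (lift (F.join (E.map F (fst X X)) (E.map F (snd X X))) (toUnit E.obj ≫ G.bot)) :=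
  ⟨⟨hX.prod hX, isCompactHausdorff_point⟩,
    ⟨hX.nonempty_sierpinskiPower, (hX.prod hX).nonempty_sierpinskiPower,
      isCompactHausdorff_point.nonempty_sierpinskiPower⟩,
    fun E F G => ⟨imageMap E G, isRightAdjointOf_imageMap hX.compact E G,
      fun _ h => classified_comp_imageMap hX.compact E G h, isInserter_singletonMap hX E F G⟩⟩
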